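/- Let $(\Omega,d,\mu)$ be an RD-space: a metric space with a Borel measure such that every ball has positive finite measure, $\mu(\{x\})=0$ for all $x$, and there are constants $0<C_1\le 1\le C_2$, $0<k\le n$ with $$C_1\lambda^k\mu(B(x,r))\le\mu(B(x,\lambda r))\le C_2\lambda^n\mu(B(x,r))\qquad(x\in\Omega,\ r>0,\ \lambda\ge1).$$ Let $X$ be a rearrangement invariant Banach function space on $\Omega$ with the Fatou property, let $1\le p<\infty$, and let $X^{(p)}=\{f:|f|^p\in X\}$ with $\|f\|_{X^{(p)}}=\||f|^p\|_X^{1/p}$. For measurable $f:\Omega\to\mathbb R$ and $t>0$ put $$E_{X^{(p)}}(f,t)=\Big\|\frac1{\mu(B(x,t))}\int_{B(x,t)}|f(x)-f(y)|\,d\mu(y)\Big\|_{X^{(p)}},\qquad \mathcal E_{X^{(p)}}(f,t)=\Big\|\Big(\frac1{\mu(B(x,t))}\int_{B(x,t)}|f(x)-f(y)|^p\,d\mu(y)\Big)^{1/p}\Big\|_{X^{(p)}},$$ the norms being taken in the variable $x$. Let $D(f)$ be the set of measurable $g\ge0$ such that $|f(x)-f(y)|\le d(x,y)(g(x)+g(y))$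 for all $x,y$ outside a null set. The homogeneous Hajłasz–Sobolev space $\dot M^{1,X^{(p)}}$ consists of all $f\in L^1+L^\infty$ with $\|f\|_{\dot M^{1,X^{(p)}}}=\inf_{g\in D(f)}\|g\|_{X^{(p)}}<\infty$, and $M^{1,X^{(p)}}=\dot M^{1,X^{(p)}}\cap X^{(p)}$ with norm $\|f\|_{X^{(p)}}+\|f\|_{\dot M^{1,X^{(p)}}}$. Let $$K(f,t,X_0,X_1)=\inf\{\|f_0\|_{X_0}+t\|f_1\|_{X_1}:\ f=f_0+f_1,\ f_0\in X_0,\ f_1\in X_1\},$$ which is $+\infty$ if $f\notin X_0+X_1$; norms are $+\infty$ outside their spaces. Then there is a constant $C>0$, independent of $f$ and $t$, such that for all $f\in X^{(p)}+\dot M^{1,X^{(p)}}$ and all $t>0$, with values in $[0,\infty]$, $$E_{X^{(p)}}(f,t)\le\mathcal E_{X^{(p)}}(f,t)\le C\,K(f,t,X^{(p)},\dot M^{1,X^{(p)}}),$$ $$K(f,t,X^{(p)},\dot M^{1,X^{(p)}})\le C\sum_{j=0}^\infty2^{-j}E_{X^{(p)}}(f,2^jt),\qquad \sum_{j=0}^\infty2^{-j}E_{X^{(p)}}(f,2^jt)\le\sum_{j=0}^\infty2^{-j}\mathcal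 E_{X^{(p)}}(f,2^jt),$$ and $$C^{-1}K(f,t,X^{(p)},M^{1,X^{(p)}})\le K(f,t,X^{(p)},\dot M^{1,X^{(p)}})+\min(1,t)\|f\|_{X^{(p)}}\le C\,K(f,t,X^{(p)},M^{1,X^{(p)}}).$$ -/

import Mathlib

open MeasureTheory
open scoped ENNReal NNReal

namespace HajlaszBesov

variable {Ω : Type*}

/-- `(Ω, d, μ)` is an RD-space: balls have positive finite measure, points are null sets, and the
two-sided estimate `C₁ lᵏ μ(B(x,r)) ≤ μ(B(x,l r)) ≤ C₂ lⁿ μ(B(x,r))` holds for all `l ≥ 1`. -/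
structure IsRDSpace [MetricSpace Ω] [MeasurableSpace Ω] (μ : Measure Ω) : Prop where
  ball_pos : ∀ (x : Ω) (r : ℝ), 0 < r → 0 < μ (Metric.ball x r)
  ball_finite : ∀ (x : Ω) (r : ℝ), 0 < r → μ (Metric.ball x r) < ∞
  atom_free : ∀ x : Ω, μ {x} = 0
  doubling_and_reverse : ∃ C₁ C₂ k n : ℝ, 0 < C₁ ∧ C₁ ≤ 1 ∧ 1 ≤ C₂ ∧ 0 < k ∧ k ≤ n ∧
    ∀ (x : Ω) (r l : ℝ), 0 < r → 1 ≤ l →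
      ENNReal.ofReal (C₁ * l ^ k) * μ (Metric.ball x r) ≤ μ (Metric.ball x (l * r)) ∧
      μ (Metric.ball x (l * r)) ≤ ENNReal.ofReal (C₂ * l ^ n) * μ (Metric.ball x r)

/-- The decreasing rearrangement `f^*(s) = inf {t ≥ 0 : μ {f > t} ≤ s}` of a nonnegative
function `f`. -/
noncomputable def rearrangement [MeasurableSpace Ω] (μ : Measure Ω) (f : Ω → ℝ≥0∞) (s : ℝ) :
    ℝ≥0∞ :=
  sInf {t : ℝ≥0∞ | μ {x | t < f x} ≤ ENNReal.ofReal s}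

/-- `ρ` is the norm of a rearrangement invariant Banach function space `X` with the Fatou property,
given as a function norm on the cone of (a.e.-)measurable functions with values in `[0, ∞]`; the
norm of a real-valued `f` is `ρ |f|`, and `f` belongs to `X` if this is finite. -/
structure IsRearrangementInvariantNorm [MeasurableSpace Ω] (μ : Measure Ω)
    (ρ : (Ω → ℝ≥0∞) → ℝ≥0∞) : Prop where
  eq_zero_iff : ∀ f, AEMeasurable f μ → (ρ f = 0 ↔ f =ᵐ[μ] 0)
  homogeneous : ∀ (a : ℝ≥0) (f), AEMeasurable f μ → ρ (fun x => a * f x) = a * ρ f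
  triangle : ∀ f g, AEMeasurable f μ → AEMeasurable g μ → ρ (fun x => f x + g x) ≤ ρ f + ρ g
  mono : ∀ f g, AEMeasurable f μ → AEMeasurable g μ → (∀ᵐ x ∂μ, f x ≤ g x) → ρ f ≤ ρ g
  fatou : ∀ f : ℕ → Ω → ℝ≥0∞, (∀ m, AEMeasurable (f m) μ) →
    (∀ᵐ x ∂μ, Monotone fun m => f m x) → ρ (fun x => ⨆ m, f m x) = ⨆ m, ρ (f m)
  indicator_finite : ∀ A, MeasurableSet A → μ A < ∞ → ρ (A.indicator 1) < ∞
  integral_le : ∀ A, MeasurableSet A → μ A < ∞ → ∃ C : ℝ≥0, ∀ f, AEMeasurable f μ →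
    ∫⁻ x in A, f x ∂μ ≤ C * ρ f
  rearrangement_invariant : ∀ f g, AEMeasurable f μ → AEMeasurable g μ →
    (∀ᵐ s ∂(volume.restrict (Set.Ioi (0 : ℝ))), rearrangement μ f s ≤ rearrangement μ g s) →
    ρ f ≤ ρ g

/-- The norm of the `p`-convexification `X^{(p)}`: `‖f‖_{X^{(p)}} = ‖ |f|^p ‖_X ^ {1/p}`. -/
noncomputable def convexification (p : ℝ) (ρ : (Ω → ℝ≥0∞) → ℝ≥0∞) : (Ω → ℝ≥0∞) → ℝ≥0∞ :=
  fun f => (ρ fun x => f x ^ p) ^ (1 / p)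

/-- The norm of a real-valued function. -/
noncomputable def fnNorm (ρ : (Ω → ℝ≥0∞) → ℝ≥0∞) (f : Ω → ℝ) : ℝ≥0∞ :=
  ρ fun x => ‖f x‖ₑ

/-- The function space with norm `ρ`. -/
def fnSpace [MeasurableSpace Ω] (μ : Measure Ω) (ρ : (Ω → ℝ≥0∞) → ℝ≥0∞) : Set (Ω → ℝ) :=
  {f | AEMeasurable f μ ∧ fnNorm ρ f < ∞}

/-- The space `L¹ + L^∞`. -/
def L1AddLinf [MeasurableSpace Ω] (μ : Measure Ω) : Set (Ω → ℝ) :=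
  {f | ∃ a b : Ω → ℝ, MemLp a 1 μ ∧ MemLp b ∞ μ ∧ f =ᵐ[μ] a + b}

/-- `D(f)`: the set of `1`-gradients of `f`, i.e. nonnegative measurable `g` such that
`|f x - f y| ≤ d(x, y) (g x + g y)` for all `x, y` outside a null set. -/
def oneGradients [MetricSpace Ω] [MeasurableSpace Ω] (μ : Measure Ω) (f : Ω → ℝ) :
    Set (Ω → ℝ) :=
  {g | AEMeasurable g μ ∧ (∀ x, 0 ≤ g x) ∧
    ∃ N : Set Ω, μ N = 0 ∧ ∀ x ∉ N, ∀ y ∉ N, |f x - f y| ≤ dist x y * (g x + g y)}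

/-- The homogeneous Hajłasz-Sobolev seminorm (infinite if there is no `1`-gradient in `X`). -/
noncomputable def homSobolevNorm [MetricSpace Ω] [MeasurableSpace Ω] (μ : Measure Ω)
    (ρ : (Ω → ℝ≥0∞) → ℝ≥0∞) (f : Ω → ℝ) : ℝ≥0∞ :=
  ⨅ g ∈ oneGradients μ f, fnNorm ρ g

/-- The homogeneous Hajłasz-Sobolev space. -/
def homSobolevSpace [MetricSpace Ω] [MeasurableSpace Ω] (μ : Measure Ω)
    (ρ : (Ω → ℝ≥0∞) → ℝ≥0∞) : Set (Ω → ℝ) :=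
  {f | f ∈ L1AddLinf μ ∧ homSobolevNorm μ ρ f < ∞}

/-- The norm of the (inhomogeneous) Hajłasz-Sobolev space. -/
noncomputable def sobolevNorm [MetricSpace Ω] [MeasurableSpace Ω] (μ : Measure Ω)
    (ρ : (Ω → ℝ≥0∞) → ℝ≥0∞) (f : Ω → ℝ) : ℝ≥0∞ :=
  fnNorm ρ f + homSobolevNorm μ ρ f

/-- The (inhomogeneous) Hajłasz-Sobolev space. -/
def sobolevSpace [MetricSpace Ω] [MeasurableSpace Ω] (μ : Measure Ω)
    (ρ : (Ω → ℝ≥0∞) → ℝ≥0∞) : Set (Ω → ℝ) :=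
  homSobolevSpace μ ρ ∩ fnSpace μ ρ

/-- The sum `X₀ + X₁` of two spaces of functions (equality of functions is equality a.e.). -/
def sumSpace [MeasurableSpace Ω] (μ : Measure Ω) (X₀ X₁ : Set (Ω → ℝ)) : Set (Ω → ℝ) :=
  {f | ∃ f₀ ∈ X₀, ∃ f₁ ∈ X₁, f =ᵐ[μ] f₀ + f₁}

/-- Peetre's `K`-functional of the couple `(X₀, X₁)` with (semi)norms `N₀`, `N₁`; it is infinite
if `f` is not in `X₀ + X₁`. -/
noncomputable def KFunctional [MeasurableSpace Ω] (μ : Measure Ω) (X₀ X₁ : Set (Ω → ℝ))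
    (N₀ N₁ : (Ω → ℝ) → ℝ≥0∞) (f : Ω → ℝ) (t : ℝ) : ℝ≥0∞ :=
  ⨅ (f₀ ∈ X₀) (f₁ ∈ X₁) (_ : f =ᵐ[μ] f₀ + f₁), N₀ f₀ + ENNReal.ofReal t * N₁ f₁

/-- `K(f, t, X, Ṁ^{1,X})`. -/
noncomputable def homK [MetricSpace Ω] [MeasurableSpace Ω] (μ : Measure Ω)
    (ρ : (Ω → ℝ≥0∞) → ℝ≥0∞) (f : Ω → ℝ) (t : ℝ) : ℝ≥0∞ :=
  KFunctional μ (fnSpace μ ρ) (homSobolevSpace μ ρ) (fnNorm ρ) (homSobolevNorm μ ρ) f t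

/-- `K(f, t, X, M^{1,X})`. -/
noncomputable def inhomK [MetricSpace Ω] [MeasurableSpace Ω] (μ : Measure Ω)
    (ρ : (Ω → ℝ≥0∞) → ℝ≥0∞) (f : Ω → ℝ) (t : ℝ) : ℝ≥0∞ :=
  KFunctional μ (fnSpace μ ρ) (sobolevSpace μ ρ) (fnNorm ρ) (sobolevNorm μ ρ) f t

/-- The modulus `E_X(f, t)`: the `X`-norm of `x ↦ ⨍_{B(x,t)} |f x - f y| dμ(y)`. -/
noncomputable def modulus [MetricSpace Ω] [MeasurableSpace Ω] (μ : Measure Ω)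
    (ρ : (Ω → ℝ≥0∞) → ℝ≥0∞) (f : Ω → ℝ) (t : ℝ) : ℝ≥0∞ :=
  ρ fun x => ⨍⁻ y in Metric.ball x t, ‖f x - f y‖ₑ ∂μ

/-- The `p`-modulus: the `X`-norm of `x ↦ (⨍_{B(x,t)} |f x - f y|^p dμ(y))^{1/p}`. -/
noncomputable def pModulus [MetricSpace Ω] [MeasurableSpace Ω] (μ : Measure Ω) (p : ℝ)
    (ρ : (Ω → ℝ≥0∞) → ℝ≥0∞) (f : Ω → ℝ) (t : ℝ) : ℝ≥0∞ :=
  ρ fun x => (⨍⁻ y in Metric.ball x t, ‖f x - f y‖ₑ ^ p ∂μ) ^ (1 / p)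

end HajlaszBesov

open HajlaszBesov

/-!
The proof has three ingredients.

*Averaging operators.* The averages `x ↦ ⨍_{B(x,t)} h` are bounded in every rearrangement invariant
norm `ρ` with the Fatou property, uniformly in `t`
(`IsRearrangementInvariantNorm.exists_average_le`). Instead of interpolating between `L¹` and `L^∞`,
they are dominated by finitely many conditional expectations on disjoint families of balls, using a
bounded number of separated families of centres (`IsRDSpace.exists_separated_families`). A
conditional expectation is a contraction (`IsRearrangementInvariantNorm.condExp_le`): as points are
null sets, each ball splits into `m` pieces of equal measure which are successive layers of `h`, and
shifting the values of the resulting step function cyclically through the pieces of each ball yields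
`m` equimeasurable functions whose mean is, for bounded `h` and up to an error `O(1 / m)`, at least
the conditional expectation.
The bound for the `p`-modulus follows (`IsRearrangementInvariantNorm.exists_pModulus_le_homK`): if
`f = f₀ + f₁` and `g` is a `1`-gradient of `f₁`, then `|f x - f y| ≤ h x + h y` for `d(x, y) < t`
with `h = |f₀| + t g`, and the averaging operator is applied to `h ^ p`.

*Smoothing.* For the converse, `f` is decomposed by averaging it against a Lipschitz tent of scale
`t` (`mollify`). Since subtracting the constant `f x` commutes with this average, both `f - mollify
f` at `x` and the Lipschitz estimate of `mollify f` near `x` are controlled by the mean oscillation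
`⨍_{B(x,4t)} |f x - f y|` (`mollify_local`). At distances of order `2 ^ j * t` the difference `f x -
f y` is controlled by the oscillations at that scale, so that `t⁻¹ ∑ 2⁻ʲ ⨍_{B(x,2ʲt)} |f x - f y|`
is, up to a factor, a `1`-gradient of `mollify f` (`enorm_mollify_sub_le`). No bound on averaging
operators enters here, only the countable triangle inequality
(`IsRearrangementInvariantNorm.exists_homK_le`).

*The inhomogeneous couple.* The last two inequalities hold for any function norm, by comparing
decompositions (`IsRearrangementInvariantNorm.inhomK_le`,
`IsRearrangementInvariantNorm.homK_add_le`).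

The convexification of a rearrangement invariant norm is again one
(`isRearrangementInvariantNorm_convexification`), so all but the first ingredient may be stated for
a general norm.
-/

namespace HajlaszBesov

/-! ### Basic consequences of the doubling property -/

theorem IsRDSpace.sigmaFinite {Ω : Type*} [MetricSpace Ω] [MeasurableSpace Ω]
    {μ : Measure Ω} (hμ : IsRDSpace μ) : SigmaFinite μ := by
  rcases isEmpty_or_nonempty Ω with hΩ | ⟨⟨x₀⟩⟩
  · rw [Measure.eq_zero_of_isEmpty μ]; infer_instance
  · refine ⟨⟨⟨fun n => Metric.ball x₀ (n + 1), fun _ => trivial,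
      fun n => hμ.ball_finite x₀ _ (by positivity), ?_⟩⟩⟩
    refine Set.eq_univ_of_forall fun x => Set.mem_iUnion.2 ?_
    obtain ⟨n, hn⟩ := exists_nat_gt (dist x x₀)
    exact ⟨n, by rw [Metric.mem_ball]; linarith⟩

theorem IsRDSpace.countable_of_separated {Ω : Type*} [MetricSpace Ω] [MeasurableSpace Ω]
    [BorelSpace Ω] {μ : Measure Ω} (hμ : IsRDSpace μ) {s : Set Ω} {r : ℝ} (hr : 0 < r)
    (hs : s.Pairwise fun x y => r ≤ dist x y) : s.Countable := by
  have := hμ.sigmaFinite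
  have h := Measure.countable_meas_pos_of_disjoint_iUnion (μ := μ)
    (As := fun x : s => Metric.ball (x : Ω) (r / 2)) (fun _ => measurableSet_ball) (by
      intro x y hxy
      refine Metric.ball_disjoint_ball ?_
      have := hs x.2 y.2 (fun h => hxy (Subtype.ext h))
      linarith)
  have h2 : {i : s | 0 < μ (Metric.ball (i : Ω) (r / 2))} = Set.univ :=
    Set.eq_univ_of_forall fun i => hμ.ball_pos _ _ (by positivity)
  rw [h2, Set.countable_univ_iff] at h
  exact Set.countable_coe_iff.1 h

/-- Every set `A` in a metric space contains a maximal `r`-separated subset, and the latter is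
an `r`-net of `A`. -/
theorem exists_maximal_separated {Ω : Type*} [MetricSpace Ω] (A : Set Ω) {r : ℝ} (hr : 0 < r) :
    ∃ s ⊆ A, (s.Pairwise fun x y => r ≤ dist x y) ∧ ∀ x ∈ A, ∃ y ∈ s, dist x y < r := by
  obtain ⟨m, hm⟩ := zorn_subset {s : Set Ω | s ⊆ A ∧ s.Pairwise fun x y => r ≤ dist x y} (by
    intro c hc hch
    refine ⟨⋃₀ c, ⟨Set.sUnion_subset fun s hs => (hc hs).1, ?_⟩, fun s => Set.subset_sUnion_of_mem⟩
    rw [Set.pairwise_sUnion hch.directedOn]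
    exact fun s hs => (hc hs).2)
  refine ⟨m, hm.1.1, hm.1.2, fun x hx => ?_⟩
  by_contra! hcon
  have hins : insert x m ∈ {s : Set Ω | s ⊆ A ∧ s.Pairwise fun x y => r ≤ dist x y} := by
    refine ⟨Set.insert_subset hx hm.1.1, ?_⟩
    rw [Set.pairwise_insert]
    exact ⟨hm.1.2, fun b hb _ => ⟨hcon b hb, by rw [dist_comm]; exact hcon b hb⟩⟩
  have hxm : x ∈ m := hm.2 hins (Set.subset_insert x m) (Set.mem_insert x m)
  have := hcon x hxm
  rw [dist_self] at this
  linarith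

theorem IsRDSpace.secondCountableTopology {Ω : Type*} [MetricSpace Ω] [MeasurableSpace Ω]
    [BorelSpace Ω] {μ : Measure Ω} (hμ : IsRDSpace μ) : SecondCountableTopology Ω := by
  refine Metric.secondCountable_of_almost_dense_set fun ε hε => ?_
  obtain ⟨s, -, hs, hs'⟩ := exists_maximal_separated (Set.univ : Set Ω) hε
  exact ⟨s, hμ.countable_of_separated hε hs, fun x => by
    obtain ⟨y, hy, hxy⟩ := hs' x trivial
    exact ⟨y, hy, hxy.le⟩⟩

theorem IsRDSpace.exists_doubling {Ω : Type*} [MetricSpace Ω] [MeasurableSpace Ω]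
    {μ : Measure Ω} (hμ : IsRDSpace μ) {l : ℝ} (hl : 1 ≤ l) :
    ∃ D : ℝ≥0, 1 ≤ D ∧ ∀ (x : Ω) (r : ℝ), 0 < r →
      μ (Metric.ball x (l * r)) ≤ D * μ (Metric.ball x r) := by
  obtain ⟨C₁, C₂, k, n, -, -, hC₂, hk, hkn, h⟩ := hμ.doubling_and_reverse
  refine ⟨(C₂ * l ^ n).toNNReal, ?_, fun x r hr => (h x r l hr hl).2⟩
  rw [Real.one_le_toNNReal]
  exact one_le_mul_of_one_le_of_one_le hC₂ (Real.one_le_rpow hl (hk.le.trans hkn))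

/-! ### Subsets of prescribed measure -/

/-- Sierpiński's theorem for a finite measure on the line without atoms. -/
theorem exists_Iic_measure_eq (ν : Measure ℝ) [IsFiniteMeasure ν] (hν : ∀ x, ν {x} = 0)
    {δ : ℝ≥0∞} (h0 : 0 < δ) (hδ : δ < ν Set.univ) : ∃ c : ℝ, ν (Set.Iic c) = δ := by
  have hmono : Monotone fun c => ν (Set.Iic c) := fun a b hab =>
    measure_mono (Set.Iic_subset_Iic.2 hab)
  obtain ⟨lo, hlo⟩ : ∃ c, ν (Set.Iic c) < δ := by
    have h1 : ⋂ n : ℕ, Set.Iic (-(n : ℝ)) = ∅ := by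
      refine Set.eq_empty_of_forall_notMem fun x hx => ?_
      obtain ⟨n, hn⟩ := exists_nat_gt (-x)
      have := Set.mem_Iic.1 (Set.mem_iInter.1 hx n)
      linarith
    have h2 := tendsto_measure_iInter_atTop (μ := ν) (s := fun n : ℕ => Set.Iic (-(n : ℝ)))
      (fun _ => measurableSet_Iic.nullMeasurableSet)
      (fun m n hmn => Set.Iic_subset_Iic.2 (neg_le_neg (Nat.cast_le.2 hmn)))
      ⟨0, measure_ne_top _ _⟩
    rw [h1, measure_empty] at h2
    obtain ⟨n, hn⟩ := (h2.eventually (gt_mem_nhds h0)).exists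
    exact ⟨_, hn⟩
  obtain ⟨hi, hhi⟩ : ∃ c, δ < ν (Set.Iic c) :=
    ((tendsto_measure_Iic_atTop ν).eventually (lt_mem_nhds hδ)).exists
  set A : Set ℝ := {c | ν (Set.Iic c) ≤ δ} with hA
  have hbdd : BddAbove A := ⟨hi, fun c hc => by
    by_contra! hcon
    exact absurd (hhi.trans_le (hmono hcon.le)) (not_lt.2 hc)⟩
  refine ⟨sSup A, le_antisymm ?_ ?_⟩
  · have h1 : ν (Set.Iic (sSup A)) = ν (Set.Iio (sSup A)) := by
      refine le_antisymm ?_ (measure_mono Set.Iio_subset_Iic_self)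
      rw [← Set.Iio_union_right]
      exact (measure_union_le _ _).trans (by rw [hν, add_zero])
    obtain ⟨u, hu, hlt, hlim⟩ := exists_seq_strictMono_tendsto (sSup A)
    have h2 : Set.Iio (sSup A) = ⋃ n, Set.Iic (u n) := by
      ext x
      simp only [Set.mem_Iio, Set.mem_iUnion, Set.mem_Iic]
      exact ⟨fun hx => ((hlim.eventually (lt_mem_nhds hx)).exists).imp fun _ => le_of_lt,
        fun ⟨n, hn⟩ => hn.trans_lt (hlt n)⟩
    rw [h1, h2, (monotone_nat_of_le_succ fun n =>
      Set.Iic_subset_Iic.2 (hu.monotone n.le_succ)).measure_iUnion]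
    refine iSup_le fun n => ?_
    obtain ⟨c, hc, hcu⟩ := exists_lt_of_lt_csSup ⟨lo, hlo.le⟩ (hlt n)
    exact (hmono hcu.le).trans hc
  · obtain ⟨u, hu, hlt, hlim⟩ := exists_seq_strictAnti_tendsto (sSup A)
    have h2 : Set.Iic (sSup A) = ⋂ n, Set.Iic (u n) := by
      ext x
      simp only [Set.mem_iInter, Set.mem_Iic]
      exact ⟨fun hx n => hx.trans (hlt n).le, fun hx => ge_of_tendsto' hlim hx⟩
    rw [h2, (antitone_nat_of_succ_le (f := fun n => Set.Iic (u n)) fun n =>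
      Set.Iic_subset_Iic.2 (hu.antitone n.le_succ)).measure_iInter
        (fun _ => measurableSet_Iic.nullMeasurableSet) ⟨0, measure_ne_top _ _⟩]
    refine le_iInf fun n => ?_
    by_contra! hcon
    exact absurd (le_csSup hbdd hcon.le) (not_le.2 (hlt n))

/-- Sierpiński's theorem: in a separable metric space whose points are null sets, a set of finite
measure has subsets of every smaller measure. A measurable injection into the line reduces it to
`exists_Iic_measure_eq`. -/
theorem exists_measurable_subset_measure_eq {Ω : Type*} [MetricSpace Ω] [MeasurableSpace Ω]
    [BorelSpace Ω] [SecondCountableTopology Ω] {μ : Measure Ω} (hμ : ∀ x, μ {x} = 0)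
    {E : Set Ω} (hE : MeasurableSet E) (hfin : μ E ≠ ∞) {δ : ℝ≥0∞} (hδ : δ ≤ μ E) :
    ∃ S ⊆ E, MeasurableSet S ∧ μ S = δ := by
  rcases eq_or_ne δ 0 with rfl | h0
  · exact ⟨∅, Set.empty_subset _, MeasurableSet.empty, measure_empty⟩
  rcases hδ.eq_or_lt with rfl | hlt
  · exact ⟨E, subset_rfl, hE, rfl⟩
  obtain ⟨e, he, heinj⟩ := MeasurableSpace.measurable_injection_nat_bool_of_countablySeparated Ω
  have hemb := measurableEmbedding_embeddingReal (ℕ → Bool)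
  set ψ : Ω → ℝ := fun x => embeddingReal (ℕ → Bool) (e x)
  have hψ : Measurable ψ := hemb.measurable.comp he
  have hψinj : Function.Injective ψ := hemb.injective.comp heinj
  have : IsFiniteMeasure (μ.restrict E) := ⟨by rw [Measure.restrict_apply_univ]; exact hfin.lt_top⟩
  set ν : Measure ℝ := (μ.restrict E).map ψ
  have : IsFiniteMeasure ν := inferInstance
  obtain ⟨c, hc⟩ := exists_Iic_measure_eq ν (fun y => by
      rw [Measure.map_apply hψ (measurableSet_singleton y)]
      refine le_antisymm ((Measure.restrict_apply_le _ _).trans ?_) zero_le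
      have hsub : (ψ ⁻¹' {y}).Subsingleton := fun a ha b hb => hψinj (ha.trans hb.symm)
      rcases hsub.eq_empty_or_singleton with h | ⟨x, h⟩
      · rw [h, measure_empty]
      · rw [h, hμ]) (pos_iff_ne_zero.2 h0) (by
      rw [Measure.map_apply hψ MeasurableSet.univ, Set.preimage_univ, Measure.restrict_apply_univ]
      exact hlt)
  rw [Measure.map_apply hψ measurableSet_Iic,
    Measure.restrict_apply (hψ measurableSet_Iic)] at hc
  exact ⟨_, Set.inter_subset_right, (hψ measurableSet_Iic).inter hE, hc⟩

/-- A top layer of prescribed measure: `S` carries the largest values of `g` on `Q`, and `a`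
separates them from the rest. -/
theorem exists_top_layer {Ω : Type*} [MetricSpace Ω] [MeasurableSpace Ω]
    [BorelSpace Ω] [SecondCountableTopology Ω] {μ : Measure Ω} (hμ : ∀ x, μ {x} = 0)
    {Q : Set Ω} (hQ : MeasurableSet Q) (hfin : μ Q ≠ ∞) {δ : ℝ≥0∞} (hδ : δ ≤ μ Q)
    {g : Ω → ℝ≥0∞} (hg : Measurable g) {R : ℝ≥0∞} (hR : ∀ x ∈ Q, g x ≤ R) :
    ∃ S ⊆ Q, ∃ a ≤ R, MeasurableSet S ∧ μ S = δ ∧ (∀ x ∈ S, a ≤ g x) ∧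
      ∀ x ∈ Q \ S, g x ≤ a := by
  set A : Set ℝ≥0∞ := {a | μ (Q ∩ {x | a < g x}) ≤ δ} with hA
  have hRA : R ∈ A := by
    have : Q ∩ {x | R < g x} = ∅ := by
      ext x; simp only [Set.mem_inter_iff, Set.mem_ofPred_eq, Set.mem_empty_iff_false, iff_false,
        not_and, not_lt]; exact hR x
    rw [hA, Set.mem_ofPred_eq, this, measure_empty]; exact zero_le
  have hmeas : ∀ a, MeasurableSet (Q ∩ {x | a < g x}) := fun a =>
    hQ.inter (measurableSet_lt measurable_const hg)
  have hanti : ∀ a b, a ≤ b → Q ∩ {x | b < g x} ⊆ Q ∩ {x | a < g x} := fun a b hab x hx =>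
    ⟨hx.1, hab.trans_lt hx.2⟩
  -- The threshold `a` is the decreasing rearrangement of `g` on `Q`, evaluated at `δ`.
  set a := sInf A with ha
  have h1 : μ (Q ∩ {x | a < g x}) ≤ δ := by
    by_cases haA : a ∈ A
    · exact haA
    obtain ⟨u, hu, hlim, huA⟩ := exists_seq_tendsto_sInf ⟨R, hRA⟩ (OrderBot.bddBelow A)
    have h2 : Q ∩ {x | a < g x} = ⋃ n, Q ∩ {x | u n < g x} := by
      ext x
      simp only [Set.mem_inter_iff, Set.mem_ofPred_eq, Set.mem_iUnion]
      constructor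
      · rintro ⟨hxQ, hx⟩
        exact ((hlim.eventually (gt_mem_nhds hx)).exists).imp fun n hn => ⟨hxQ, hn⟩
      · rintro ⟨n, hxQ, hx⟩
        exact ⟨hxQ, (sInf_le (huA n)).trans_lt hx⟩
    rw [h2, Directed.measure_iUnion]
    · exact iSup_le fun n => huA n
    · exact Monotone.directed_le fun m n hmn => hanti _ _ (hu hmn)
  have h2 : δ ≤ μ (Q ∩ {x | a ≤ g x}) := by
    rcases eq_or_ne a 0 with h0 | h0
    · have : Q ∩ {x | a ≤ g x} = Q := by simp [h0]
      rwa [this]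
    obtain ⟨u, hu, hlt, hlim⟩ := exists_seq_strictMono_tendsto' (pos_iff_ne_zero.2 h0)
    have h2 : Q ∩ {x | a ≤ g x} = ⋂ n, Q ∩ {x | u n < g x} := by
      ext x
      simp only [Set.mem_inter_iff, Set.mem_ofPred_eq, Set.mem_iInter]
      exact ⟨fun hx n => ⟨hx.1, (hlt n).2.trans_le hx.2⟩,
        fun hx => ⟨(hx 0).1, le_of_tendsto' hlim fun n => (hx n).2.le⟩⟩
    rw [h2, (antitone_nat_of_succ_le fun n => hanti _ _ (hu.monotone n.le_succ)).measure_iInter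
        (fun n => (hmeas _).nullMeasurableSet)
        ⟨0, ne_top_of_le_ne_top hfin (measure_mono Set.inter_subset_left)⟩]
    refine le_iInf fun n => ?_
    by_contra! hcon
    exact absurd (sInf_le (s := A) hcon.le) (not_le.2 (hlt n).2)
  have hsub : Q ∩ {x | a < g x} ⊆ Q ∩ {x | a ≤ g x} := fun x hx =>
    ⟨hx.1, (show a < g x from hx.2).le⟩
  have hm2 : MeasurableSet (Q ∩ {x | a ≤ g x}) :=
    hQ.inter (measurableSet_le measurable_const hg)
  have hfin1 : μ (Q ∩ {x | a < g x}) ≠ ∞ :=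
    ne_top_of_le_ne_top hfin (measure_mono Set.inter_subset_left)
  obtain ⟨S, hS, hSm, hSδ⟩ := exists_measurable_subset_measure_eq hμ
    (hm2.diff (hmeas a)) (ne_top_of_le_ne_top hfin
      (measure_mono (Set.sdiff_subset.trans Set.inter_subset_left)))
    (δ := δ - μ (Q ∩ {x | a < g x})) (by
      rw [measure_sdiff hsub (hmeas a).nullMeasurableSet hfin1]
      exact tsub_le_tsub_right h2 _)
  refine ⟨(Q ∩ {x | a < g x}) ∪ S, Set.union_subset Set.inter_subset_left fun x hx => (hS hx).1.1,
    a, sInf_le hRA, (hmeas a).union hSm, ?_, ?_, ?_⟩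
  · rw [measure_union (Set.disjoint_left.2 fun x hx hx' => (hS hx').2 hx) hSm, hSδ,
      add_tsub_cancel_of_le h1]
  · rintro x (hx | hx)
    · exact le_of_lt hx.2
    · exact (hS hx).1.2
  · rintro x ⟨hxQ, hx⟩
    by_contra! hcon
    exact hx (Or.inl ⟨hxQ, hcon⟩)

/-- A set of measure `m * δ` splits into `m` pieces of measure `δ` on which `g` is bounded below by
constants `b j`, in such a way that the corresponding lower sum misses the integral of `g` by at
most the contribution of a single piece. The pieces are successive top layers of `g`; each bounds
the next one from above, so the lower sum telescopes against the upper one. -/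
theorem exists_equipartition {Ω : Type*} [MetricSpace Ω] [MeasurableSpace Ω]
    [BorelSpace Ω] [SecondCountableTopology Ω] {μ : Measure Ω} (hμ : ∀ x, μ {x} = 0)
    {δ : ℝ≥0∞} (hδ : δ ≠ ∞) {g : Ω → ℝ≥0∞} (hg : Measurable g) (m : ℕ) :
    ∀ (Q : Set Ω) (R : ℝ≥0∞), MeasurableSet Q → μ Q = m * δ → (∀ x ∈ Q, g x ≤ R) →
      ∃ (P : Fin m → Set Ω) (b : Fin m → ℝ≥0∞), (∀ j, MeasurableSet (P j)) ∧
        (Pairwise fun i j => Disjoint (P i) (P j)) ∧ (⋃ j, P j) ⊆ Q ∧ μ (Q \ ⋃ j, P j) = 0 ∧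
        (∀ j, μ (P j) = δ) ∧ (∀ j, ∀ x ∈ P j, b j ≤ g x) ∧
        ∫⁻ x in Q, g x ∂μ ≤ δ * (∑ j, b j + R) := by
  induction m with
  | zero =>
    intro Q R hQ hm hR
    have h0 : μ Q = 0 := by simpa using hm
    refine ⟨Fin.elim0, Fin.elim0, fun j => j.elim0, fun j => j.elim0, by simp, by simpa using h0,
      fun j => j.elim0, fun j => j.elim0, ?_⟩
    rw [setLIntegral_measure_zero _ _ h0]
    exact zero_le
  | succ m ih =>
    intro Q R hQ hm hR
    have hfin : μ Q ≠ ∞ := by rw [hm]; exact ENNReal.mul_ne_top (ENNReal.natCast_ne_top _) hδ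
    obtain ⟨S, hSQ, a, haR, hSm, hSδ, hSa, hQa⟩ := exists_top_layer hμ hQ hfin (δ := δ) (by
      rw [hm]; push_cast; rw [add_mul, one_mul]; exact le_add_self) hg hR
    have hdiff : μ (Q \ S) = m * δ := by
      rw [measure_sdiff hSQ hSm.nullMeasurableSet (by rw [hSδ]; exact hδ), hSδ, hm]
      push_cast
      rw [add_mul, one_mul, ENNReal.add_sub_cancel_right hδ]
    obtain ⟨P, b, hPm, hPd, hPQ, hP0, hPδ, hPb, hint⟩ := ih (Q \ S) a (hQ.diff hSm) hdiff hQa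
    refine ⟨Fin.cons S P, Fin.cons a b, ?_, ?_, ?_, ?_, ?_, ?_, ?_⟩
    · exact Fin.cases hSm hPm
    · have hSP : ∀ j, Disjoint S (P j) := fun j =>
        Set.disjoint_left.2 fun x hx hx' => (hPQ (Set.mem_iUnion.2 ⟨j, hx'⟩)).2 hx
      intro i j hij
      induction i using Fin.cases with
      | zero =>
        induction j using Fin.cases with
        | zero => exact absurd rfl hij
        | succ j => simpa using hSP j
      | succ i =>
        induction j using Fin.cases with
        | zero => simpa using (hSP i).symm
        | succ j => simpa using hPd (fun h => hij (congrArg Fin.succ h))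
    · refine Set.iUnion_subset (Fin.cases hSQ fun j => ?_)
      exact (Set.subset_iUnion P j).trans (hPQ.trans Set.sdiff_subset)
    · refine le_antisymm ((measure_mono ?_).trans hP0.le) zero_le
      rintro x ⟨hxQ, hx⟩
      simp only [Set.mem_iUnion, not_exists] at hx ⊢
      exact ⟨⟨hxQ, hx 0⟩, by simpa using fun j => hx (Fin.succ j)⟩
    · exact Fin.cases hSδ hPδ
    · exact Fin.cases hSa hPb
    · rw [← Set.inter_union_sdiff Q S, Set.inter_eq_self_of_subset_right hSQ,
        lintegral_union (hQ.diff hSm) Set.disjoint_sdiff_right, Fin.sum_univ_succ]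
      simp only [Fin.cons_zero, Fin.cons_succ]
      calc ∫⁻ x in S, g x ∂μ + ∫⁻ x in Q \ S, g x ∂μ
          ≤ R * δ + δ * (∑ j, b j + a) := by
            refine add_le_add ?_ hint
            rw [← hSδ, ← setLIntegral_const]
            exact setLIntegral_mono measurable_const fun x hx => hR x (hSQ hx)
        _ = _ := by ring

/-! ### Step functions and function norms -/

theorem sum_indicator_of_mem {Ω κ : Type*} [Fintype κ] {P : κ → Set Ω}
    (hd : Pairwise fun i j => Disjoint (P i) (P j)) (c : κ → ℝ≥0∞) {q : κ} {x : Ω} (hx : x ∈ P q) :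
    ∑ q, (P q).indicator (fun _ => c q) x = c q := by
  classical
  rw [Finset.sum_eq_single q, Set.indicator_of_mem hx]
  · intro i _ hi
    exact Set.indicator_of_notMem (fun h => Set.disjoint_left.1 (hd hi) h hx) _
  · exact fun h => absurd (Finset.mem_univ q) h

theorem sum_indicator_of_notMem {Ω κ : Type*} [Fintype κ] {P : κ → Set Ω} (c : κ → ℝ≥0∞)
    {x : Ω} (hx : ∀ q, x ∉ P q) : ∑ q, (P q).indicator (fun _ => c q) x = 0 :=
  Finset.sum_eq_zero fun q _ => Set.indicator_of_notMem (hx q) _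


section FunctionNorm

variable {Ω : Type*} [MeasurableSpace Ω] {μ : Measure Ω} {ρ : (Ω → ℝ≥0∞) → ℝ≥0∞}

namespace IsRearrangementInvariantNorm

theorem apply_zero (hρ : IsRearrangementInvariantNorm μ ρ) : ρ (fun _ => 0) = 0 :=
  (hρ.eq_zero_iff _ aemeasurable_const).2 Filter.EventuallyEq.rfl

theorem congr_ae (hρ : IsRearrangementInvariantNorm μ ρ) {f g : Ω → ℝ≥0∞}
    (hf : AEMeasurable f μ) (h : f =ᵐ[μ] g) : ρ f = ρ g :=
  le_antisymm (hρ.mono _ _ hf (hf.congr h) h.le) (hρ.mono _ _ (hf.congr h) hf h.symm.le)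

theorem sum_le (hρ : IsRearrangementInvariantNorm μ ρ) {ι : Type*} (s : Finset ι)
    {f : ι → Ω → ℝ≥0∞} (hf : ∀ i, AEMeasurable (f i) μ) :
    ρ (fun x => ∑ i ∈ s, f i x) ≤ ∑ i ∈ s, ρ (f i) := by
  classical
  induction s using Finset.induction_on with
  | empty => simpa using hρ.apply_zero.le
  | insert a s ha ih =>
    simp only [Finset.sum_insert ha]
    exact (hρ.triangle _ _ (hf a) (Finset.aemeasurable_fun_sum s fun i _ => hf i)).trans
      (add_le_add le_rfl ih)

/-- The form in which the Fatou property is used: a bound on the members of an increasing sequence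
passes to whatever lies below its supremum. -/
theorem le_of_le_iSup (hρ : IsRearrangementInvariantNorm μ ρ) {f : Ω → ℝ≥0∞}
    {F : ℕ → Ω → ℝ≥0∞} {C : ℝ≥0∞} (hf : AEMeasurable f μ) (hF : ∀ n, AEMeasurable (F n) μ)
    (hmono : ∀ x, Monotone fun n => F n x) (hle : ∀ x, f x ≤ ⨆ n, F n x)
    (hC : ∀ n, ρ (F n) ≤ C) : ρ f ≤ C :=
  (hρ.mono _ _ hf (AEMeasurable.iSup hF) (Filter.Eventually.of_forall hle)).trans
    ((hρ.fatou F hF (Filter.Eventually.of_forall hmono)).le.trans (iSup_le hC))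

theorem tsum_le (hρ : IsRearrangementInvariantNorm μ ρ) {f : ℕ → Ω → ℝ≥0∞}
    (hf : ∀ i, AEMeasurable (f i) μ) : ρ (fun x => ∑' i, f i x) ≤ ∑' i, ρ (f i) := by
  refine hρ.le_of_le_iSup (F := fun n x => ∑ i ∈ Finset.range n, f i x)
    (AEMeasurable.tsum hf) (fun n => Finset.aemeasurable_fun_sum _ fun i _ => hf i)
    (fun x m n hmn => Finset.sum_le_sum_of_subset (Finset.range_subset_range.2 hmn))
    (fun x => ENNReal.tsum_eq_iSup_nat.le) fun n => ?_
  exact (hρ.sum_le _ hf).trans (ENNReal.sum_le_tsum _)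

theorem const_mul (hρ : IsRearrangementInvariantNorm μ ρ) {a : ℝ≥0∞} (ha : a ≠ ∞)
    {f : Ω → ℝ≥0∞} (hf : AEMeasurable f μ) : ρ (fun x => a * f x) = a * ρ f := by
  lift a to ℝ≥0 using ha
  exact hρ.homogeneous a f hf

end IsRearrangementInvariantNorm

theorem measurable_sum_indicator {κ : Type*} [Fintype κ] {P : κ → Set Ω}
    (hP : ∀ q, MeasurableSet (P q)) (c : κ → ℝ≥0∞) :
    Measurable fun x => ∑ q, (P q).indicator (fun _ => c q) x :=
  Finset.measurable_fun_sum _ fun q _ => measurable_const.indicator (hP q)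

theorem measure_lt_sum_indicator {κ : Type*} [Fintype κ] {P : κ → Set Ω}
    (hP : ∀ q, MeasurableSet (P q)) (hd : Pairwise fun i j => Disjoint (P i) (P j))
    (c : κ → ℝ≥0∞) (a : ℝ≥0∞) :
    μ {x | a < ∑ q, (P q).indicator (fun _ => c q) x} = ∑ q, if a < c q then μ (P q) else 0 := by
  classical
  have h : {x | a < ∑ q, (P q).indicator (fun _ => c q) x}
      = ⋃ q ∈ Finset.univ.filter fun q => a < c q, P q := by
    ext x
    simp only [Set.mem_ofPred_eq, Finset.mem_filter, Finset.mem_univ, true_and, Set.mem_iUnion,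
      exists_prop]
    constructor
    · intro hx
      by_cases hq : ∃ q, x ∈ P q
      · obtain ⟨q, hq⟩ := hq
        rw [sum_indicator_of_mem hd c hq] at hx
        exact ⟨q, hx, hq⟩
      · rw [sum_indicator_of_notMem c (not_exists.1 hq)] at hx
        exact absurd hx not_lt_zero
    · rintro ⟨q, hq, hx⟩
      rwa [sum_indicator_of_mem hd c hx]
  rw [h, measure_biUnion_finset (fun i _ j _ hij => hd hij) (fun q _ => hP q), Finset.sum_filter]

/-- A step function does not change its norm when its values are permuted among steps of equal
measure. -/
theorem IsRearrangementInvariantNorm.sum_indicator_perm_le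
    (hρ : IsRearrangementInvariantNorm μ ρ) {κ : Type*} [Fintype κ] {P : κ → Set Ω}
    (hP : ∀ q, MeasurableSet (P q)) (hd : Pairwise fun i j => Disjoint (P i) (P j))
    (c : κ → ℝ≥0∞) (σ : κ ≃ κ) (hσ : ∀ q, μ (P (σ q)) = μ (P q)) :
    ρ (fun x => ∑ q, (P q).indicator (fun _ => c (σ q)) x)
      ≤ ρ (fun x => ∑ q, (P q).indicator (fun _ => c q) x) := by
  refine hρ.rearrangement_invariant _ _ (measurable_sum_indicator hP _).aemeasurable
    (measurable_sum_indicator hP _).aemeasurable (Filter.Eventually.of_forall fun s => ?_)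
  refine le_of_eq ?_
  unfold rearrangement
  congr 1
  ext a
  simp only [Set.mem_ofPred_eq]
  rw [measure_lt_sum_indicator hP hd, measure_lt_sum_indicator hP hd,
    ← Equiv.sum_comp σ fun q => if a < c q then μ (P q) else 0]
  simp only [hσ]

end FunctionNorm

/-! ### Conditional expectations on a disjoint family of sets -/

section CondExp

variable {Ω : Type*} [MetricSpace Ω] [MeasurableSpace Ω] [BorelSpace Ω]
  [SecondCountableTopology Ω] {μ : Measure Ω} {ρ : (Ω → ℝ≥0∞) → ℝ≥0∞}

/-- One step of the approximation: up to the error `R / (m + 1)`, the averages of `g` over the sets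
`Q i` are the mean of `m + 1` step functions, each equimeasurable with a minorant of `g`. The step
functions arise from a lower sum of `g` by cyclic shifts of the values inside each `Q i`. -/
theorem IsRearrangementInvariantNorm.condExp_le_add (hρ : IsRearrangementInvariantNorm μ ρ)
    (hμ : ∀ x, μ {x} = 0) {ι : Type*} [Fintype ι] {Q : ι → Set Ω}
    (hQ : ∀ i, MeasurableSet (Q i)) (hd : Pairwise fun i j => Disjoint (Q i) (Q j))
    (hpos : ∀ i, μ (Q i) ≠ 0) (hfin : ∀ i, μ (Q i) ≠ ∞)
    {g : Ω → ℝ≥0∞} (hg : Measurable g) {R : ℝ≥0} (hR : ∀ x, g x ≤ R) (m : ℕ) :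
    ρ (fun x => ∑ i, (Q i).indicator (fun _ => ⨍⁻ y in Q i, g y ∂μ) x)
      ≤ ρ g + ((m + 1 : ℕ) : ℝ≥0∞)⁻¹ * (R * ρ ((⋃ i, Q i).indicator 1)) := by
  have hM0 : ((m + 1 : ℕ) : ℝ≥0∞) ≠ 0 := by exact_mod_cast m.succ_ne_zero
  have hMt : ((m + 1 : ℕ) : ℝ≥0∞) ≠ ∞ := ENNReal.natCast_ne_top _
  have hδ : ∀ i, μ (Q i) / ((m + 1 : ℕ) : ℝ≥0∞) ≠ ∞ := fun i => ENNReal.div_ne_top (hfin i) hM0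
  choose P b hPm hPd hPQ hP0 hPδ hPb hint using fun i =>
    exists_equipartition hμ (hδ i) hg (m + 1) (Q i) R (hQ i)
      (ENNReal.mul_div_cancel hM0 hMt).symm fun x _ => hR x
  set P' : ι × Fin (m + 1) → Set Ω := fun q => P q.1 q.2
  set b' : ι × Fin (m + 1) → ℝ≥0∞ := fun q => b q.1 q.2
  have hPm' : ∀ q, MeasurableSet (P' q) := fun q => hPm q.1 q.2
  have hPQ' : ∀ i j, P i j ⊆ Q i := fun i j => (Set.subset_iUnion (P i) j).trans (hPQ i)
  have hPd' : Pairwise fun p q => Disjoint (P' p) (P' q) := by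
    rintro ⟨i, j⟩ ⟨i', j'⟩ hne
    by_cases hi : i = i'
    · subst hi
      exact hPd i fun h => hne (Prod.ext rfl h)
    · exact (hd hi).mono (hPQ' i j) (hPQ' i' j')
  -- The shift by `k` in each block.
  set σ : Fin (m + 1) → (ι × Fin (m + 1) ≃ ι × Fin (m + 1)) := fun k =>
    Equiv.prodCongr (Equiv.refl ι) (Equiv.addRight k)
  set h : Fin (m + 1) → Ω → ℝ≥0∞ := fun k x => ∑ q, (P' q).indicator (fun _ => b' (σ k q)) x
  have hhm : ∀ k, AEMeasurable (h k) μ := fun k => (measurable_sum_indicator hPm' _).aemeasurable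
  have hhg : ∀ k, ρ (h k) ≤ ρ g := by
    intro k
    refine (hρ.sum_indicator_perm_le hPm' hPd' b' (σ k) (fun q => ?_)).trans
      (hρ.mono _ _ (measurable_sum_indicator hPm' _).aemeasurable hg.aemeasurable
        (Filter.Eventually.of_forall fun x => ?_))
    · exact (hPδ _ _).trans (hPδ q.1 q.2).symm
    · by_cases hq : ∃ q, x ∈ P' q
      · obtain ⟨q, hq⟩ := hq
        rw [sum_indicator_of_mem hPd' b' hq]
        exact hPb q.1 q.2 x hq
      · rw [sum_indicator_of_notMem b' (not_exists.1 hq)]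
        exact zero_le
  have hUm : MeasurableSet (⋃ i, Q i) := MeasurableSet.iUnion hQ
  have hUi : AEMeasurable ((⋃ i, Q i).indicator (1 : Ω → ℝ≥0∞)) μ :=
    (measurable_one.indicator hUm).aemeasurable
  have hle : ∀ᵐ x ∂μ, ∑ i, (Q i).indicator (fun _ => ⨍⁻ y in Q i, g y ∂μ) x ≤
      ((m + 1 : ℕ) : ℝ≥0∞)⁻¹ * (∑ k, h k x + R * (⋃ i, Q i).indicator 1 x) := by
    have hae : ∀ᵐ x ∂μ, ∀ i, x ∉ Q i \ ⋃ j, P i j :=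
      ae_all_iff.2 fun i => measure_eq_zero_iff_ae_notMem.1 (hP0 i)
    filter_upwards [hae] with x hx
    by_cases hq : ∃ i, x ∈ Q i
    · obtain ⟨i, hi⟩ := hq
      obtain ⟨j, hj⟩ : ∃ j, x ∈ P i j := by
        by_contra hcon
        exact hx i ⟨hi, fun h => hcon (Set.mem_iUnion.1 h)⟩
      have h1 : ∀ k, h k x = b i (j + k) := fun k =>
        sum_indicator_of_mem (q := (i, j)) hPd' _ hj
      rw [sum_indicator_of_mem hd _ hi, Set.indicator_of_mem (Set.mem_iUnion.2 ⟨i, hi⟩)]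
      simp only [h1, Pi.one_apply, mul_one]
      have hshift : ∑ k, b i (j + k) = ∑ k, b i k := Equiv.sum_comp (Equiv.addLeft j) (b i)
      rw [hshift, setLAverage_eq]
      refine (ENNReal.div_le_div_right (hint i) _).trans (le_of_eq ?_)
      rw [div_eq_mul_inv, div_eq_mul_inv]
      calc μ (Q i) * ((m + 1 : ℕ) : ℝ≥0∞)⁻¹ * (∑ j, b i j + R) * (μ (Q i))⁻¹
          = (μ (Q i) * (μ (Q i))⁻¹) * (((m + 1 : ℕ) : ℝ≥0∞)⁻¹ * (∑ j, b i j + R)) := by ring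
        _ = _ := by rw [ENNReal.mul_inv_cancel (hpos i) (hfin i), one_mul]
    · rw [sum_indicator_of_notMem _ (not_exists.1 hq)]
      exact zero_le
  have hsm : AEMeasurable (fun x => ∑ k, h k x) μ :=
    Finset.aemeasurable_fun_sum _ fun k _ => hhm k
  calc ρ (fun x => ∑ i, (Q i).indicator (fun _ => ⨍⁻ y in Q i, g y ∂μ) x)
      ≤ ρ (fun x => ((m + 1 : ℕ) : ℝ≥0∞)⁻¹ * (∑ k, h k x + R * (⋃ i, Q i).indicator 1 x)) :=
        hρ.mono _ _ (measurable_sum_indicator hQ _).aemeasurable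
          ((hsm.add (hUi.const_mul _)).const_mul _) hle
    _ = ((m + 1 : ℕ) : ℝ≥0∞)⁻¹ * ρ (fun x => ∑ k, h k x + R * (⋃ i, Q i).indicator 1 x) :=
        hρ.const_mul (ENNReal.inv_ne_top.2 hM0) (hsm.add (hUi.const_mul _))
    _ ≤ ((m + 1 : ℕ) : ℝ≥0∞)⁻¹ *
          (((m + 1 : ℕ) : ℝ≥0∞) * ρ g + R * ρ ((⋃ i, Q i).indicator 1)) := by
        refine mul_le_mul_right ((hρ.triangle _ _ hsm (hUi.const_mul _)).trans
          (add_le_add ?_ (hρ.homogeneous R _ hUi).le)) _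
        refine (hρ.sum_le _ hhm).trans ((Finset.sum_le_sum fun k _ => hhg k).trans ?_)
        simp
    _ = _ := by rw [mul_add, ← mul_assoc, ENNReal.inv_mul_cancel hM0 hMt, one_mul]

/-- The conditional expectation on a countable family of disjoint sets of positive finite measure
is a contraction for every rearrangement invariant norm with the Fatou property over a nonatomic
measure. -/
theorem IsRearrangementInvariantNorm.condExp_le (hρ : IsRearrangementInvariantNorm μ ρ)
    (hμ : ∀ x, μ {x} = 0) {ι : Type*} [Countable ι] {Q : ι → Set Ω}
    (hQ : ∀ i, MeasurableSet (Q i)) (hd : Pairwise fun i j => Disjoint (Q i) (Q j))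
    (hpos : ∀ i, μ (Q i) ≠ 0) (hfin : ∀ i, μ (Q i) ≠ ∞)
    {g : Ω → ℝ≥0∞} (hg : AEMeasurable g μ) :
    ρ (fun x => ∑' i, (Q i).indicator (fun _ => ⨍⁻ y in Q i, g y ∂μ) x) ≤ ρ g := by
  classical
  -- Bounded functions and finite families.
  have hbdd : ∀ (s : Finset ι) (g : Ω → ℝ≥0∞) (R : ℝ≥0), Measurable g → (∀ x, g x ≤ R) →
      ρ (fun x => ∑ i ∈ s, (Q i).indicator (fun _ => ⨍⁻ y in Q i, g y ∂μ) x) ≤ ρ g := by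
    intro s g R hg hR
    have hUfin : μ (⋃ i : s, Q i) < ∞ := by
      refine (measure_iUnion_le _).trans_lt ?_
      rw [tsum_fintype]
      exact ENNReal.sum_lt_top.2 fun i _ => (hfin i).lt_top
    have hc : (R : ℝ≥0∞) * ρ ((⋃ i : s, Q i).indicator 1) ≠ ∞ :=
      ENNReal.mul_ne_top ENNReal.coe_ne_top
        (hρ.indicator_finite _ (MeasurableSet.iUnion fun i : s => hQ i) hUfin).ne
    have hlim : Filter.Tendsto (fun m : ℕ => ρ g + ((m + 1 : ℕ) : ℝ≥0∞)⁻¹ *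
        (R * ρ ((⋃ i : s, Q i).indicator 1))) Filter.atTop (nhds (ρ g + 0 *
        (R * ρ ((⋃ i : s, Q i).indicator 1)))) :=
      tendsto_const_nhds.add (ENNReal.Tendsto.mul_const
        (ENNReal.tendsto_inv_nat_nhds_zero.comp (Filter.tendsto_add_atTop_nat 1)) (Or.inr hc))
    rw [zero_mul, add_zero] at hlim
    refine ge_of_tendsto' hlim fun m => ?_
    have := hρ.condExp_le_add hμ (Q := fun i : s => Q i) (fun i => hQ i)
      (fun i j hij => hd fun h => hij (Subtype.ext h)) (fun i => hpos i) (fun i => hfin i) hg hR m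
    refine le_of_eq_of_le (congrArg ρ (funext fun x => ?_)) this
    exact (Finset.sum_coe_sort s
      fun i => (Q i).indicator (fun _ => ⨍⁻ y in Q i, g y ∂μ) x).symm
  have hsum : ∀ (s : Finset ι) (c : ι → ℝ≥0∞),
      AEMeasurable (fun x => ∑ i ∈ s, (Q i).indicator (fun _ => c i) x) μ := fun s c =>
    (Finset.measurable_fun_sum _ fun i _ => measurable_const.indicator (hQ i)).aemeasurable
  -- Finite families.
  have hfinite : ∀ (s : Finset ι) (g : Ω → ℝ≥0∞), Measurable g →
      ρ (fun x => ∑ i ∈ s, (Q i).indicator (fun _ => ⨍⁻ y in Q i, g y ∂μ) x) ≤ ρ g := by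
    intro s g hg
    have hmin : ∀ n : ℕ, Measurable fun x => min (g x) n := fun n => hg.min measurable_const
    have hav : ∀ i, Monotone fun n : ℕ => ⨍⁻ y in Q i, min (g y) n ∂μ := fun i m n hmn =>
      lintegral_mono fun y => min_le_min le_rfl (Nat.cast_le.2 hmn)
    refine hρ.le_of_le_iSup (F := fun n x => ∑ i ∈ s, (Q i).indicator
      (fun _ => ⨍⁻ y in Q i, min (g y) n ∂μ) x) (hsum s _) (fun n => hsum s _) (fun x m n hmn =>
        Finset.sum_le_sum fun i _ => Set.indicator_le_indicator (hav i hmn)) (fun x => ?_) fun n =>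
        (hbdd s _ n (hmin n) fun x => min_le_right _ _).trans
          (hρ.mono _ _ (hmin n).aemeasurable hg.aemeasurable
            (Filter.Eventually.of_forall fun x => min_le_left _ _))
    rw [← ENNReal.finsetSum_iSup_of_monotone (s := s)
      (f := fun i (n : ℕ) => (Q i).indicator (fun _ => ⨍⁻ y in Q i, min (g y) n ∂μ) x)
      (fun i m n hmn => Set.indicator_le_indicator (hav i hmn))]
    refine Finset.sum_le_sum fun i _ => ?_
    by_cases hx : x ∈ Q i
    · simp only [Set.indicator_of_mem hx, setLAverage_eq]
      rw [← ENNReal.iSup_div, ← lintegral_iSup hmin fun m n hmn y =>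
        min_le_min le_rfl (Nat.cast_le.2 hmn)]
      refine ENNReal.div_le_div_right (lintegral_mono fun y => ?_) _
      refine le_of_eq ((inf_iSup_eq (g y) fun n : ℕ => (n : ℝ≥0∞)).symm.trans ?_).symm
      rw [ENNReal.iSup_natCast, inf_top_eq]
    · simp [Set.indicator_of_notMem hx]
  have hmeas : ∀ g : Ω → ℝ≥0∞, Measurable g →
      ρ (fun x => ∑' i, (Q i).indicator (fun _ => ⨍⁻ y in Q i, g y ∂μ) x) ≤ ρ g := by
    intro g hg
    obtain ⟨s, hs, hlim⟩ := Filter.exists_seq_monotone_tendsto_atTop_atTop (Finset ι)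
    refine hρ.le_of_le_iSup (F := fun n x => ∑ i ∈ s n, (Q i).indicator
      (fun _ => ⨍⁻ y in Q i, g y ∂μ) x) (Measurable.tsum fun i =>
        measurable_const.indicator (hQ i)).aemeasurable (fun n => hsum _ _)
      (fun x m n hmn => Finset.sum_le_sum_of_subset (hs hmn)) (fun x => ?_) fun n =>
        hfinite _ g hg
    exact le_of_tendsto' (ENNReal.summable.hasSum.comp hlim) fun n =>
      le_iSup (fun n => ∑ i ∈ s n, (Q i).indicator (fun _ => ⨍⁻ y in Q i, g y ∂μ) x) n
  have hav : ∀ i, ⨍⁻ y in Q i, g y ∂μ = ⨍⁻ y in Q i, hg.mk g y ∂μ := fun i =>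
    laverage_congr (ae_restrict_of_ae hg.ae_eq_mk)
  simp only [hav]
  exact (hmeas _ hg.measurable_mk).trans (hρ.congr_ae hg hg.ae_eq_mk).ge

end CondExp

/-! ### Averages over balls -/

theorem setLAverage_le_mul_of_subset {Ω : Type*} [MeasurableSpace Ω] {μ : Measure Ω} {A B : Set Ω}
    (hAB : A ⊆ B) {D : ℝ≥0} (hD : 1 ≤ D) (h : μ B ≤ D * μ A) (f : Ω → ℝ≥0∞) :
    ⨍⁻ x in A, f x ∂μ ≤ D * ⨍⁻ x in B, f x ∂μ := by
  have hD0 : (D : ℝ≥0∞) ≠ 0 := by exact_mod_cast (zero_lt_one.trans_le hD).ne'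
  rw [setLAverage_eq, setLAverage_eq, ← mul_div_assoc]
  refine (ENNReal.div_le_div_right (lintegral_mono_set hAB) _).trans ?_
  rw [← ENNReal.mul_div_mul_left _ _ hD0 ENNReal.coe_ne_top]
  exact ENNReal.div_le_div_left h _

section

variable {Ω : Type*} [MetricSpace Ω] [MeasurableSpace Ω] [BorelSpace Ω]
  [SecondCountableTopology Ω] {μ : Measure Ω} [SFinite μ]

theorem measurable_setLAverage_ball {F : Ω → Ω → ℝ≥0∞} (hF : Measurable (Function.uncurry F))
    (t : ℝ) : Measurable fun x => ⨍⁻ y in Metric.ball x t, F x y ∂μ := by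
  have hS : MeasurableSet {p : Ω × Ω | dist p.2 p.1 < t} :=
    measurableSet_lt (measurable_snd.dist measurable_fst) measurable_const
  have key : ∀ G : Ω → Ω → ℝ≥0∞, Measurable (Function.uncurry G) →
      Measurable fun x => ∫⁻ y in Metric.ball x t, G x y ∂μ := by
    intro G hG
    have h := (hG.indicator hS).lintegral_prod_right' (ν := μ)
    have heq : (fun x => ∫⁻ y in Metric.ball x t, G x y ∂μ) = fun x => ∫⁻ y,
        {p : Ω × Ω | dist p.2 p.1 < t}.indicator (Function.uncurry G) (x, y) ∂μ := by
      funext x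
      rw [← lintegral_indicator measurableSet_ball]
      rfl
    rw [heq]
    exact h
  have h1 := key (fun _ _ => 1) measurable_const
  simp only [setLIntegral_one] at h1
  simp only [setLAverage_eq]
  exact (key F hF).div h1

end

/-- In a doubling space, boundedly many disjoint families of balls of radius `2 * t` suffice to
cover every ball of radius `t`: the centres form finitely many `4 * t`-separated sets whose union is
a `t`-net. They are found by repeatedly removing from a maximal `t`-separated set a maximal
`4 * t`-separated subset; by a volume count this exhausts the set in boundedly many steps. -/
theorem IsRDSpace.exists_separated_families {Ω : Type*} [MetricSpace Ω] [MeasurableSpace Ω]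
    [BorelSpace Ω] {μ : Measure Ω} (hμ : IsRDSpace μ) :
    ∃ K : ℕ, ∀ t : ℝ, 0 < t → ∃ M : ℕ → Set Ω,
      (∀ k, (M k).Pairwise fun x y => 4 * t ≤ dist x y) ∧
      ∀ x, ∃ k < K, ∃ z ∈ M k, dist x z < t := by
  obtain ⟨D, hD1, hD⟩ := hμ.exists_doubling (l := 18) (by norm_num)
  refine ⟨⌊D⌋₊ + 1, fun t ht => ?_⟩
  obtain ⟨Z, -, hZ, hZnet⟩ := exists_maximal_separated (Set.univ : Set Ω) ht
  choose sel hsub hsep hnet using fun A : Set Ω =>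
    exists_maximal_separated A (show 0 < 4 * t by positivity)
  set R : ℕ → Set Ω := fun k => Nat.rec Z (fun _ A => A \ sel A) k with hR
  have hRs : ∀ k, R (k + 1) = R k \ sel (R k) := fun k => rfl
  have hanti : Antitone R := antitone_nat_of_succ_le fun k => by
    rw [hRs]; exact Set.sdiff_subset
  have hRZ : ∀ k, R k ⊆ Z := fun k => hanti (Nat.zero_le k)
  have hempty : ∀ z, z ∉ R (⌊D⌋₊ + 1) := by
    intro z hz
    choose y hyM hy using fun k : Fin (⌊D⌋₊ + 1) =>
      hnet (R k) z (hanti k.2.le hz)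
    have hlt : ∀ i j : Fin (⌊D⌋₊ + 1), i < j → y i ≠ y j := by
      intro i j hij h
      have : y j ∈ R (i + 1) := hanti (Nat.succ_le_of_lt hij) (hsub _ (hyM j))
      rw [hRs, ← h] at this
      exact this.2 (hyM i)
    have hdisj : Pairwise fun i j => Disjoint (Metric.ball (y i) (t / 2))
        (Metric.ball (y j) (t / 2)) := by
      intro i j hij
      refine Metric.ball_disjoint_ball ?_
      have hne : y i ≠ y j := by
        rcases lt_or_gt_of_ne hij with h | h
        · exact hlt i j h
        · exact (hlt j i h).symm
      have := hZ (hRZ _ (hsub _ (hyM i))) (hRZ _ (hsub _ (hyM j))) hne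
      linarith
    have hV0 := hμ.ball_pos z (5 * t) (by positivity)
    have hVt := hμ.ball_finite z (5 * t) (by positivity)
    have hsum : ∑ i, μ (Metric.ball (y i) (t / 2)) ≤ μ (Metric.ball z (5 * t)) := by
      have hU := measure_iUnion (μ := μ) hdisj fun _ => measurableSet_ball
      rw [tsum_fintype] at hU
      rw [← hU]
      refine measure_mono (Set.iUnion_subset fun i => Metric.ball_subset_ball' ?_)
      have := hy i
      rw [dist_comm] at this
      linarith
    have hle : ∀ i, μ (Metric.ball z (5 * t)) ≤ D * μ (Metric.ball (y i) (t / 2)) := by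
      intro i
      refine (measure_mono (Metric.ball_subset_ball' ?_)).trans (hD (y i) (t / 2) (by positivity))
      have := hy i
      linarith
    have hcount : ((⌊D⌋₊ + 1 : ℕ) : ℝ≥0∞) * μ (Metric.ball z (5 * t)) ≤
        D * μ (Metric.ball z (5 * t)) := by
      refine le_trans ?_ (mul_le_mul_right hsum _)
      rw [Finset.mul_sum]
      refine le_trans ?_ (Finset.sum_le_sum fun i _ => hle i)
      simp
    rw [ENNReal.mul_le_mul_iff_left hV0.ne' hVt.ne] at hcount
    have h3 : ((⌊D⌋₊ + 1 : ℕ) : ℝ≥0) ≤ D := by exact_mod_cast hcount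
    have := Nat.lt_floor_add_one D
    push_cast at h3
    exact absurd this (not_lt.2 h3)
  refine ⟨fun k => sel (R k), fun k => hsep _, fun x => ?_⟩
  obtain ⟨z, hz, hxz⟩ := hZnet x trivial
  by_contra! hcon
  refine hempty z ?_
  have : ∀ k ≤ ⌊D⌋₊ + 1, z ∈ R k := by
    intro k
    induction k with
    | zero => exact fun _ => hz
    | succ k ih =>
      intro hk
      rw [hRs]
      exact ⟨ih (by omega), fun h => absurd hxz (not_lt.2 (hcon k (by omega) z h))⟩
  exact this _ le_rfl

/-- The averaging operators over balls of a fixed radius are bounded in every rearrangement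
invariant norm, uniformly in the radius: they are dominated by finitely many conditional
expectations on disjoint families of balls. -/
theorem IsRearrangementInvariantNorm.exists_average_le {Ω : Type*} [MetricSpace Ω]
    [MeasurableSpace Ω] [BorelSpace Ω] {μ : Measure Ω} {ρ : (Ω → ℝ≥0∞) → ℝ≥0∞}
    (hρ : IsRearrangementInvariantNorm μ ρ) (hμ : IsRDSpace μ) :
    ∃ C : ℝ≥0, ∀ t : ℝ, 0 < t → ∀ h : Ω → ℝ≥0∞, AEMeasurable h μ →
      ρ (fun x => ⨍⁻ y in Metric.ball x t, h y ∂μ) ≤ C * ρ h := by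
  have := hμ.sigmaFinite
  have := hμ.secondCountableTopology
  obtain ⟨D, hD1, hD⟩ := hμ.exists_doubling (l := 3) (by norm_num)
  obtain ⟨K, hK⟩ := hμ.exists_separated_families
  refine ⟨D * K, fun t ht h hh => ?_⟩
  obtain ⟨M, hMsep, hMnet⟩ := hK t ht
  have hMc : ∀ k, Countable (M k) := fun k =>
    Set.countable_coe_iff.2 (hμ.countable_of_separated (by positivity) (hMsep k))
  set T : ℕ → Ω → ℝ≥0∞ := fun k x => ∑' z : M k, (Metric.ball (z : Ω) (2 * t)).indicator
    (fun _ => ⨍⁻ y in Metric.ball (z : Ω) (2 * t), h y ∂μ) x with hT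
  have hTm : ∀ k, AEMeasurable (T k) μ := fun k =>
    (Measurable.tsum fun z => measurable_const.indicator measurableSet_ball).aemeasurable
  have hTle : ∀ k, ρ (T k) ≤ ρ h := fun k =>
    hρ.condExp_le hμ.atom_free (fun _ => measurableSet_ball) (fun i j hij => by
      refine Metric.ball_disjoint_ball ?_
      have := hMsep k i.2 j.2 fun h => hij (Subtype.ext h)
      linarith) (fun i => (hμ.ball_pos _ _ (by positivity)).ne')
      (fun i => (hμ.ball_finite _ _ (by positivity)).ne) hh
  have hle : ∀ x, ⨍⁻ y in Metric.ball x t, h y ∂μ ≤ D * ∑ k ∈ Finset.range K, T k x := by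
    intro x
    obtain ⟨k, hk, z, hz, hxz⟩ := hMnet x
    have h1 : ⨍⁻ y in Metric.ball x t, h y ∂μ ≤ D * ⨍⁻ y in Metric.ball z (2 * t), h y ∂μ := by
      refine setLAverage_le_mul_of_subset (Metric.ball_subset_ball' (by linarith)) hD1 ?_ h
      refine (measure_mono (Metric.ball_subset_ball' ?_)).trans (hD x t ht)
      rw [dist_comm]
      linarith
    refine h1.trans (mul_le_mul_right ?_ _)
    have h2 : ⨍⁻ y in Metric.ball z (2 * t), h y ∂μ ≤ T k x := by
      refine le_trans ?_ (ENNReal.le_tsum (⟨z, hz⟩ : M k))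
      rw [Set.indicator_of_mem (Metric.mem_ball.2 (by linarith))]
    exact h2.trans (Finset.single_le_sum (f := fun k => T k x) (fun _ _ => zero_le)
      (Finset.mem_range.2 hk))
  have hav : ∀ x, ⨍⁻ y in Metric.ball x t, h y ∂μ = ⨍⁻ y in Metric.ball x t, hh.mk h y ∂μ :=
    fun x => laverage_congr (ae_restrict_of_ae hh.ae_eq_mk)
  have hmeas : Measurable fun x => ⨍⁻ y in Metric.ball x t, h y ∂μ := by
    simp only [hav]
    exact measurable_setLAverage_ball (F := fun _ y => hh.mk h y)
      (hh.measurable_mk.comp measurable_snd) t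
  have hsum : AEMeasurable (fun x => ∑ k ∈ Finset.range K, T k x) μ :=
    Finset.aemeasurable_fun_sum _ fun k _ => hTm k
  calc ρ (fun x => ⨍⁻ y in Metric.ball x t, h y ∂μ)
      ≤ ρ (fun x => D * ∑ k ∈ Finset.range K, T k x) :=
        hρ.mono _ _ hmeas.aemeasurable (hsum.const_mul _) (Filter.Eventually.of_forall hle)
    _ = D * ρ (fun x => ∑ k ∈ Finset.range K, T k x) := hρ.homogeneous D _ hsum
    _ ≤ D * (K * ρ h) := by
        refine mul_le_mul_right ((hρ.sum_le _ hTm).trans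
          ((Finset.sum_le_sum fun k _ => hTle k).trans ?_)) _
        simp
    _ = _ := by push_cast; ring

/-! ### The convexification of a function norm -/

theorem convexification_rpow {Ω : Type*} {ρ : (Ω → ℝ≥0∞) → ℝ≥0∞}
    {p : ℝ} (hp : 0 < p) (f : Ω → ℝ≥0∞) :
    convexification p ρ f ^ p = ρ fun x => f x ^ p := by
  rw [convexification, ← ENNReal.rpow_mul, one_div, inv_mul_cancel₀ hp.ne', ENNReal.rpow_one]

theorem convexification_le_iff {Ω : Type*} {ρ : (Ω → ℝ≥0∞) → ℝ≥0∞}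
    {p : ℝ} (hp : 0 < p) {f : Ω → ℝ≥0∞} {a : ℝ≥0∞} :
    convexification p ρ f ≤ a ↔ (ρ fun x => f x ^ p) ≤ a ^ p := by
  rw [← convexification_rpow (ρ := ρ) hp, ENNReal.rpow_le_rpow_iff hp]

section Convexification

variable {Ω : Type*} [MeasurableSpace Ω] {μ : Measure Ω} {ρ : (Ω → ℝ≥0∞) → ℝ≥0∞} {p : ℝ}

theorem rearrangement_rpow (hp : 0 < p) (f : Ω → ℝ≥0∞) (s : ℝ) :
    rearrangement μ (fun x => f x ^ p) s = rearrangement μ f s ^ p := by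
  have h := (ENNReal.orderIsoRpow p hp).map_sInf {t : ℝ≥0∞ | μ {x | t < f x} ≤ ENNReal.ofReal s}
  rw [ENNReal.orderIsoRpow_apply, ← sInf_image] at h
  unfold rearrangement
  rw [h]
  congr 1
  ext t
  rw [(ENNReal.orderIsoRpow p hp).image_eq_preimage_symm]
  simp only [Set.mem_ofPred_eq, Set.mem_preimage]
  have : ∀ x, t < f x ^ p ↔ (ENNReal.orderIsoRpow p hp).symm t < f x := fun x => by
    rw [OrderIso.symm_apply_lt, ENNReal.orderIsoRpow_apply]
  simp only [this]

/-- Minkowski's inequality for the convexification, from the convexity of `x ↦ x ^ p`. -/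
theorem IsRearrangementInvariantNorm.convexification_add_le
    (hρ : IsRearrangementInvariantNorm μ ρ) (hp : 1 ≤ p) {f g : Ω → ℝ≥0∞}
    (hf : AEMeasurable f μ) (hg : AEMeasurable g μ) :
    convexification p ρ (fun x => f x + g x) ≤ convexification p ρ f + convexification p ρ g := by
  have hp0 : 0 < p := zero_lt_one.trans_le hp
  rw [convexification_le_iff hp0]
  have hfa := convexification_rpow (ρ := ρ) hp0 f
  have hgb := convexification_rpow (ρ := ρ) hp0 g
  set a := convexification p ρ f
  set b := convexification p ρ g
  have hzero : ∀ {f : Ω → ℝ≥0∞}, AEMeasurable f μ → (ρ fun x => f x ^ p) = 0 → f =ᵐ[μ] 0 := by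
    intro f hf h
    filter_upwards [(hρ.eq_zero_iff _ (hf.pow_const p)).1 h] with x hx
    exact (ENNReal.rpow_eq_zero_iff_of_pos hp0).1 hx
  rcases eq_or_ne a 0 with ha0 | ha0
  · rw [ha0, ENNReal.zero_rpow_of_pos hp0] at hfa
    rw [ha0, zero_add, hgb]
    refine (hρ.congr_ae ((hf.add hg).pow_const p) ?_).le
    filter_upwards [hzero hf hfa.symm] with x hx
    simp [hx]
  rcases eq_or_ne b 0 with hb0 | hb0
  · rw [hb0, ENNReal.zero_rpow_of_pos hp0] at hgb
    rw [hb0, add_zero, hfa]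
    refine (hρ.congr_ae ((hf.add hg).pow_const p) ?_).le
    filter_upwards [hzero hg hgb.symm] with x hx
    simp [hx]
  rcases eq_or_ne a ∞ with hat | hat
  · rw [hat, top_add, ENNReal.top_rpow_of_pos hp0]; exact le_top
  rcases eq_or_ne b ∞ with hbt | hbt
  · rw [hbt, add_top, ENNReal.top_rpow_of_pos hp0]; exact le_top
  have hs0 : a + b ≠ 0 := fun h => ha0 (add_eq_zero.1 h).1
  have hst : a + b ≠ ∞ := ENNReal.add_ne_top.2 ⟨hat, hbt⟩
  have hap0 : a ^ p ≠ 0 := fun h => ha0 ((ENNReal.rpow_eq_zero_iff_of_pos hp0).1 h)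
  have hbp0 : b ^ p ≠ 0 := fun h => hb0 ((ENNReal.rpow_eq_zero_iff_of_pos hp0).1 h)
  have hapt : a ^ p ≠ ∞ := ENNReal.rpow_ne_top_of_nonneg hp0.le hat
  have hbpt : b ^ p ≠ ∞ := ENNReal.rpow_ne_top_of_nonneg hp0.le hbt
  have hspt : (a + b) ^ p ≠ ∞ := ENNReal.rpow_ne_top_of_nonneg hp0.le hst
  have hw : a / (a + b) + b / (a + b) = 1 := by
    rw [← ENNReal.add_div, ENNReal.div_self hs0 hst]
  have hcancel : ∀ c : ℝ≥0∞, c ≠ 0 → c ≠ ∞ → ∀ y, (a + b) * (c / (a + b) * (y / c)) = y := by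
    intro c hc0 hct y
    rw [← mul_assoc, ENNReal.mul_div_cancel hs0 hst, ENNReal.mul_div_cancel hc0 hct]
  set F : Ω → ℝ≥0∞ := fun x => a / (a + b) * ((a ^ p)⁻¹ * f x ^ p)
  set G : Ω → ℝ≥0∞ := fun x => b / (a + b) * ((b ^ p)⁻¹ * g x ^ p)
  have hF : AEMeasurable F μ := ((hf.pow_const p).const_mul _).const_mul _
  have hG : AEMeasurable G μ := ((hg.pow_const p).const_mul _).const_mul _
  have hle : ∀ x, (f x + g x) ^ p ≤ (a + b) ^ p * (F x + G x) := by
    intro x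
    have h1 := ENNReal.rpow_arith_mean_le_arith_mean2_rpow (a / (a + b)) (b / (a + b))
      (f x / a) (g x / b) hw hp
    calc (f x + g x) ^ p
        = ((a + b) * (a / (a + b) * (f x / a) + b / (a + b) * (g x / b))) ^ p := by
          rw [mul_add, hcancel a ha0 hat, hcancel b hb0 hbt]
      _ = (a + b) ^ p * (a / (a + b) * (f x / a) + b / (a + b) * (g x / b)) ^ p :=
          ENNReal.mul_rpow_of_nonneg _ _ hp0.le
      _ ≤ (a + b) ^ p * (a / (a + b) * (f x / a) ^ p + b / (a + b) * (g x / b) ^ p) :=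
          mul_le_mul_right h1 _
      _ = _ := by
          rw [ENNReal.div_rpow_of_nonneg _ _ hp0.le, ENNReal.div_rpow_of_nonneg _ _ hp0.le,
            div_eq_mul_inv (f x ^ p), div_eq_mul_inv (g x ^ p), mul_comm (f x ^ p),
            mul_comm (g x ^ p)]
  have hwa : a / (a + b) ≠ ∞ := ENNReal.div_ne_top hat hs0
  have hwb : b / (a + b) ≠ ∞ := ENNReal.div_ne_top hbt hs0
  calc (ρ fun x => (f x + g x) ^ p) ≤ ρ fun x => (a + b) ^ p * (F x + G x) :=
        hρ.mono _ _ ((hf.add hg).pow_const p) ((hF.add hG).const_mul _)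
          (Filter.Eventually.of_forall hle)
    _ = (a + b) ^ p * ρ fun x => F x + G x := hρ.const_mul hspt (hF.add hG)
    _ ≤ (a + b) ^ p * (ρ F + ρ G) := mul_le_mul_right (hρ.triangle _ _ hF hG) _
    _ = (a + b) ^ p * (a / (a + b) + b / (a + b)) := by
        rw [hρ.const_mul hwa ((hf.pow_const p).const_mul _),
          hρ.const_mul hwb ((hg.pow_const p).const_mul _),
          hρ.const_mul (ENNReal.inv_ne_top.2 hap0) (hf.pow_const p),
          hρ.const_mul (ENNReal.inv_ne_top.2 hbp0) (hg.pow_const p), ← hfa, ← hgb,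
          ENNReal.inv_mul_cancel hap0 hapt, ENNReal.inv_mul_cancel hbp0 hbpt, mul_one, mul_one]
    _ = (a + b) ^ p := by rw [hw, mul_one]

/-- Jensen's inequality for averages of nonnegative functions. -/
theorem setLAverage_rpow_le {A : Set Ω} (hA : μ A ≠ ∞) (hp : 1 ≤ p)
    {f : Ω → ℝ≥0∞} (hf : AEMeasurable f μ) :
    (⨍⁻ x in A, f x ∂μ) ^ p ≤ ⨍⁻ x in A, f x ^ p ∂μ := by
  have hp0 : 0 < p := zero_lt_one.trans_le hp
  rcases eq_or_ne (μ A) 0 with h0 | h0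
  · rw [setLAverage_eq, setLIntegral_measure_zero _ _ h0, ENNReal.zero_div,
      ENNReal.zero_rpow_of_pos hp0]
    exact zero_le
  have : IsProbabilityMeasure ((μ A)⁻¹ • μ.restrict A) := ⟨by
    rw [Measure.smul_apply, Measure.restrict_apply_univ, smul_eq_mul, ENNReal.inv_mul_cancel h0 hA]⟩
  have hf' : AEMeasurable f ((μ A)⁻¹ • μ.restrict A) := hf.restrict.smul_measure _
  have h := eLpNorm_le_eLpNorm_of_exponent_le (p := 1) (q := ENNReal.ofReal p)
    (ENNReal.one_le_ofReal.2 hp) hf'.aestronglyMeasurable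
  rw [eLpNorm_one_eq_lintegral_enorm,
    eLpNorm_eq_lintegral_rpow_enorm_toReal (by simpa using hp0) ENNReal.ofReal_ne_top,
    ENNReal.toReal_ofReal hp0.le, one_div, ENNReal.le_rpow_inv_iff hp0] at h
  simpa [laverage] using h

theorem isRearrangementInvariantNorm_convexification (hρ : IsRearrangementInvariantNorm μ ρ)
    (hp : 1 ≤ p) : IsRearrangementInvariantNorm μ (convexification p ρ) := by
  have hp0 : 0 < p := zero_lt_one.trans_le hp
  refine ⟨fun f hf => ?_, fun a f hf => ?_, fun f g hf hg => hρ.convexification_add_le hp hf hg,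
    fun f g hf hg h => ?_, fun f hf h => ?_, fun A hA hAfin => ?_, fun A hA hAfin => ?_,
    fun f g hf hg h => ?_⟩
  · rw [convexification, ENNReal.rpow_eq_zero_iff_of_pos (one_div_pos.2 hp0),
      hρ.eq_zero_iff _ (hf.pow_const p)]
    refine Filter.eventually_congr (Filter.Eventually.of_forall fun x => ?_)
    exact ENNReal.rpow_eq_zero_iff_of_pos hp0
  · rw [convexification]
    simp only [ENNReal.mul_rpow_of_nonneg _ _ hp0.le]
    rw [hρ.const_mul (ENNReal.rpow_ne_top_of_nonneg hp0.le ENNReal.coe_ne_top) (hf.pow_const p),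
      ENNReal.mul_rpow_of_nonneg _ _ (one_div_pos.2 hp0).le, ← ENNReal.rpow_mul,
      mul_one_div_cancel hp0.ne', ENNReal.rpow_one, convexification]
  · exact ENNReal.rpow_le_rpow (hρ.mono _ _ (hf.pow_const p) (hg.pow_const p)
      (h.mono fun x hx => ENNReal.rpow_le_rpow hx hp0.le)) (one_div_pos.2 hp0).le
  · have h1 : (fun x => (⨆ m, f m x) ^ p) = fun x => ⨆ m, f m x ^ p := funext fun x =>
      (ENNReal.orderIsoRpow p hp0).map_iSup fun m => f m x
    rw [convexification, h1, hρ.fatou _ (fun m => (hf m).pow_const p)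
      (h.mono fun x hx m n hmn => ENNReal.rpow_le_rpow (hx hmn) hp0.le)]
    exact (ENNReal.orderIsoRpow (1 / p) (one_div_pos.2 hp0)).map_iSup _
  · have h1 : (fun x => A.indicator (1 : Ω → ℝ≥0∞) x ^ p) = A.indicator 1 := by
      funext x
      by_cases hx : x ∈ A
      · simp [hx]
      · simp [hx, hp0]
    rw [convexification, h1]
    exact ENNReal.rpow_lt_top_of_nonneg (one_div_pos.2 hp0).le (hρ.indicator_finite A hA hAfin).ne
  · obtain ⟨C, hC⟩ := hρ.integral_le A hA hAfin
    rcases eq_or_ne (μ A) 0 with h0 | h0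
    · exact ⟨0, fun f _ => by rw [setLIntegral_measure_zero _ _ h0]; exact zero_le⟩
    have hK : μ A * ((μ A)⁻¹ * C) ^ (1 / p) ≠ ∞ := ENNReal.mul_ne_top hAfin.ne
      (ENNReal.rpow_ne_top_of_nonneg (one_div_pos.2 hp0).le
        (ENNReal.mul_ne_top (ENNReal.inv_ne_top.2 h0) ENNReal.coe_ne_top))
    refine ⟨(μ A * ((μ A)⁻¹ * C) ^ (1 / p)).toNNReal, fun f hf => ?_⟩
    rw [ENNReal.coe_toNNReal hK, convexification, mul_assoc,
      ← ENNReal.mul_rpow_of_nonneg _ _ (one_div_pos.2 hp0).le,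
      ← measure_mul_setLAverage f hAfin.ne]
    refine mul_le_mul_right ?_ _
    rw [one_div, ENNReal.le_rpow_inv_iff hp0]
    refine (setLAverage_rpow_le hAfin.ne hp hf).trans ?_
    rw [setLAverage_eq, div_eq_mul_inv, mul_comm, mul_assoc]
    exact mul_le_mul_right (hC _ (hf.pow_const p)) _
  · refine ENNReal.rpow_le_rpow (hρ.rearrangement_invariant _ _ (hf.pow_const p) (hg.pow_const p)
      (h.mono fun s hs => ?_)) (one_div_pos.2 hp0).le
    rw [rearrangement_rpow hp0, rearrangement_rpow hp0]
    exact ENNReal.rpow_le_rpow hs hp0.le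

end Convexification

/-! ### Functions of finite norm -/

section FiniteNorm

variable {Ω : Type*} [MeasurableSpace Ω] {μ : Measure Ω} {ρ : (Ω → ℝ≥0∞) → ℝ≥0∞}

theorem IsRearrangementInvariantNorm.ae_lt_top [SigmaFinite μ]
    (hρ : IsRearrangementInvariantNorm μ ρ) {f : Ω → ℝ≥0∞} (hf : AEMeasurable f μ)
    (h : ρ f < ∞) : ∀ᵐ x ∂μ, f x < ∞ := by
  refine ae_of_forall_measure_lt_top_ae_restrict _ fun s hs hsfin => ?_
  obtain ⟨C, hC⟩ := hρ.integral_le s hs hsfin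
  exact ae_lt_top' hf.restrict ((hC f hf).trans_lt (ENNReal.mul_lt_top ENNReal.coe_lt_top h)).ne

theorem L1AddLinf_congr {f g : Ω → ℝ} (hf : f ∈ L1AddLinf μ) (h : f =ᵐ[μ] g) :
    g ∈ L1AddLinf μ := by
  obtain ⟨a, b, ha, hb, hab⟩ := hf
  exact ⟨a, b, ha, hb, h.symm.trans hab⟩

theorem L1AddLinf_add {f g : Ω → ℝ} (hf : f ∈ L1AddLinf μ) (hg : g ∈ L1AddLinf μ) :
    f + g ∈ L1AddLinf μ := by
  obtain ⟨a, b, ha, hb, hab⟩ := hf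
  obtain ⟨c, d, hc, hd, hcd⟩ := hg
  refine ⟨a + c, b + d, ha.add hc, hb.add hd, (hab.add hcd).trans ?_⟩
  rw [add_add_add_comm]

theorem L1AddLinf_neg {f : Ω → ℝ} (hf : f ∈ L1AddLinf μ) : -f ∈ L1AddLinf μ := by
  obtain ⟨a, b, ha, hb, hab⟩ := hf
  refine ⟨-a, -b, ha.neg, hb.neg, hab.neg.trans ?_⟩
  rw [neg_add]

theorem L1AddLinf_aemeasurable {f : Ω → ℝ} (hf : f ∈ L1AddLinf μ) : AEMeasurable f μ := by
  obtain ⟨a, b, ha, hb, hab⟩ := hf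
  exact (ha.aestronglyMeasurable.aemeasurable.add hb.aestronglyMeasurable.aemeasurable).congr
    hab.symm

theorem L1AddLinf_setLIntegral_lt_top {f : Ω → ℝ} (hf : f ∈ L1AddLinf μ) {A : Set Ω}
    (hA : μ A < ∞) : ∫⁻ x in A, ‖f x‖ₑ ∂μ < ∞ := by
  obtain ⟨a, b, ha, hb, hab⟩ := hf
  have : IsFiniteMeasure (μ.restrict A) := ⟨by rwa [Measure.restrict_apply_univ]⟩
  have h1 : MemLp (a + b) 1 (μ.restrict A) :=
    (ha.restrict A).add ((hb.restrict A).mono_exponent le_top)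
  have h2 : MemLp f 1 (μ.restrict A) := h1.ae_eq (ae_restrict_of_ae hab.symm)
  have := h2.2
  rwa [eLpNorm_one_eq_lintegral_enorm] at this

/-- A rearrangement invariant space embeds into `L¹ + L^∞`: a function of finite norm has a level
set of finite measure, for otherwise its rearrangement would be infinite and its norm would dominate
every other. -/
theorem IsRearrangementInvariantNorm.fnSpace_subset_L1AddLinf [SigmaFinite μ]
    (hρ : IsRearrangementInvariantNorm μ ρ) : fnSpace μ ρ ⊆ L1AddLinf μ := by
  rintro f ⟨hf, hfin⟩
  set f' := hf.mk f with hf'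
  have hf'm : Measurable f' := hf.measurable_mk
  have heq : f =ᵐ[μ] f' := hf.ae_eq_mk
  have hfin' : ρ (fun x => ‖f' x‖ₑ) < ∞ := by
    rwa [← hρ.congr_ae hf.enorm (heq.mono fun x hx => congrArg enorm hx)]
  have hlevel : ∃ n : ℕ, μ {x | (n : ℝ≥0∞) < ‖f' x‖ₑ} < ∞ := by
    by_contra! hcon
    have h1 : ∀ s, rearrangement μ (fun x => ‖f' x‖ₑ) s = ∞ := by
      intro s
      refine top_unique (le_sInf fun t ht => ?_)
      by_contra! htop
      obtain ⟨n, hn⟩ := ENNReal.exists_nat_gt htop.ne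
      have h2 : μ {x | (n : ℝ≥0∞) < ‖f' x‖ₑ} ≤ μ {x | t < ‖f' x‖ₑ} :=
        measure_mono fun x hx => hn.trans hx
      exact absurd (((hcon n).trans h2).trans ht) (not_le.2 ENNReal.ofReal_lt_top)
    have h2 : ρ (fun _ => ∞) < ∞ := lt_of_le_of_lt
      (hρ.rearrangement_invariant _ _ aemeasurable_const hf'm.enorm.aemeasurable
        (Filter.Eventually.of_forall fun s => by rw [h1]; exact le_top)) hfin'
    have h3 := hρ.ae_lt_top aemeasurable_const h2
    have h4 : μ {x | ((0 : ℕ) : ℝ≥0∞) < ‖f' x‖ₑ} = 0 :=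
      measure_eq_zero_iff_ae_notMem.2 (h3.mono fun x hx => absurd hx (lt_irrefl _))
    exact absurd (hcon 0) (by rw [h4]; simp)
  obtain ⟨n, hn⟩ := hlevel
  set A : Set Ω := {x | (n : ℝ≥0∞) < ‖f' x‖ₑ}
  have hA : MeasurableSet A := measurableSet_lt measurable_const hf'm.enorm
  refine ⟨A.indicator f', Aᶜ.indicator f', ⟨(hf'm.indicator hA).aestronglyMeasurable, ?_⟩,
    memLp_top_of_bound (hf'm.indicator hA.compl).aestronglyMeasurable n
      (Filter.Eventually.of_forall fun x => ?_), ?_⟩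
  · obtain ⟨C, hC⟩ := hρ.integral_le A hA hn
    rw [eLpNorm_indicator_eq_eLpNorm_restrict hA, eLpNorm_one_eq_lintegral_enorm]
    exact (hC _ hf'm.enorm.aemeasurable).trans_lt (ENNReal.mul_lt_top ENNReal.coe_lt_top hfin')
  · by_cases hx : x ∈ A
    · rw [Set.indicator_of_notMem (by simpa using hx), norm_zero]
      exact n.cast_nonneg
    · rw [Set.indicator_of_mem (by simpa using hx)]
      have : ‖f' x‖ₑ ≤ (n : ℝ≥0∞) := not_lt.1 hx
      rw [← ofReal_norm, ← ENNReal.ofReal_natCast] at this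
      exact (ENNReal.ofReal_le_ofReal_iff n.cast_nonneg).1 this
  · rw [Set.indicator_self_add_compl]
    exact heq

end FiniteNorm

/-! ### Bounds for the `K`-functional -/

section KFunctional

variable {Ω : Type*} [MeasurableSpace Ω] {μ : Measure Ω}

theorem le_mul_KFunctional_add {X₀ X₁ : Set (Ω → ℝ)} {N₀ N₁ : (Ω → ℝ) → ℝ≥0∞} {f : Ω → ℝ}
    {t : ℝ} {C : ℝ≥0} (hC : 0 < C) {a b : ℝ≥0∞}
    (h : ∀ f₀ ∈ X₀, ∀ f₁ ∈ X₁, f =ᵐ[μ] f₀ + f₁ →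
      a ≤ C * (N₀ f₀ + ENNReal.ofReal t * N₁ f₁ + b)) :
    a ≤ C * (KFunctional μ X₀ X₁ N₀ N₁ f t + b) := by
  have hC0 : (C : ℝ≥0∞) ≠ 0 := by exact_mod_cast hC.ne'
  simp only [KFunctional, ENNReal.iInf_add, ENNReal.mul_iInf_of_ne hC0 ENNReal.coe_ne_top]
  exact le_iInf fun f₀ => le_iInf fun h₀ => le_iInf fun f₁ => le_iInf fun h₁ => le_iInf fun hf =>
    h f₀ h₀ f₁ h₁ hf

theorem KFunctional_le {X₀ X₁ : Set (Ω → ℝ)} {N₀ N₁ : (Ω → ℝ) → ℝ≥0∞} {f f₀ f₁ : Ω → ℝ}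
    (t : ℝ) (h₀ : f₀ ∈ X₀) (h₁ : f₁ ∈ X₁) (hf : f =ᵐ[μ] f₀ + f₁) :
    KFunctional μ X₀ X₁ N₀ N₁ f t ≤ N₀ f₀ + ENNReal.ofReal t * N₁ f₁ :=
  (iInf₂_le f₀ h₀).trans ((iInf₂_le f₁ h₁).trans (iInf_le _ hf))

theorem IsRearrangementInvariantNorm.fnNorm_le_add {ρ : (Ω → ℝ≥0∞) → ℝ≥0∞}
    (hρ : IsRearrangementInvariantNorm μ ρ) {f f₀ f₁ : Ω → ℝ} (h₀ : AEMeasurable f₀ μ)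
    (h₁ : AEMeasurable f₁ μ) (hf : f =ᵐ[μ] f₀ + f₁) :
    fnNorm ρ f ≤ fnNorm ρ f₀ + fnNorm ρ f₁ := by
  refine (hρ.mono _ _ ((h₀.add h₁).congr hf.symm).enorm (h₀.enorm.add h₁.enorm) ?_).trans
    (hρ.triangle _ _ h₀.enorm h₁.enorm)
  filter_upwards [hf] with x hx
  rw [hx]
  exact enorm_add_le _ _

end KFunctional

section Modulus

variable {Ω : Type*} [MetricSpace Ω] [MeasurableSpace Ω] {μ : Measure Ω}
  {ρ : (Ω → ℝ≥0∞) → ℝ≥0∞}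

theorem homSobolevNorm_le {f g : Ω → ℝ} (hg : g ∈ oneGradients μ f) :
    homSobolevNorm μ ρ f ≤ fnNorm ρ g :=
  iInf₂_le g hg

theorem le_mul_homK {f : Ω → ℝ} {t : ℝ} (ht : 0 < t) {C : ℝ≥0} (hC : 0 < C) {a : ℝ≥0∞}
    (h : ∀ f₀ ∈ fnSpace μ ρ, ∀ f₁ : Ω → ℝ, f =ᵐ[μ] f₀ + f₁ → ∀ g ∈ oneGradients μ f₁,
      a ≤ C * (fnNorm ρ f₀ + ENNReal.ofReal t * fnNorm ρ g)) :
    a ≤ C * homK μ ρ f t := by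
  have hC0 : (C : ℝ≥0∞) ≠ 0 := by exact_mod_cast hC.ne'
  have ht0 : ENNReal.ofReal t ≠ 0 := by simpa using ht
  rw [← add_zero (homK μ ρ f t)]
  refine le_mul_KFunctional_add hC fun f₀ h₀ f₁ _ hf => ?_
  simp only [add_zero, homSobolevNorm, ENNReal.add_iInf,
    ENNReal.mul_iInf_of_ne hC0 ENNReal.coe_ne_top, ENNReal.mul_iInf_of_ne ht0 ENNReal.ofReal_ne_top]
  exact le_iInf fun g => le_iInf fun hg => h f₀ h₀ f₁ hf g hg

/-- Comparison of the two couples, upper bound for the inhomogeneous `K`-functional. For `t ≥ 1` the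
trivial decomposition `f = f + 0` suffices; for `t < 1` every decomposition for the homogeneous
couple serves. -/
theorem IsRearrangementInvariantNorm.inhomK_le (hρ : IsRearrangementInvariantNorm μ ρ)
    {f : Ω → ℝ} (hf : AEMeasurable f μ) {t : ℝ} (ht : 0 < t) :
    inhomK μ ρ f t ≤ 2 * (homK μ ρ f t + ENNReal.ofReal (min 1 t) * fnNorm ρ f) := by
  rcases eq_or_ne (fnNorm ρ f) ∞ with htop | hfin
  · have hm : ENNReal.ofReal (min 1 t) ≠ 0 := by simpa using ht
    rw [htop, ENNReal.mul_top hm, add_top, ENNReal.mul_top two_ne_zero]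
    exact le_top
  have hfX : f ∈ fnSpace μ ρ := ⟨hf, hfin.lt_top⟩
  have h0 : fnNorm ρ (0 : Ω → ℝ) = 0 := by simpa [fnNorm] using hρ.apply_zero
  rcases le_total 1 t with h1 | h1
  · have hgrad : (0 : Ω → ℝ) ∈ oneGradients μ 0 :=
      ⟨aemeasurable_const, fun _ => le_rfl, ∅, measure_empty, by simp⟩
    have hH : homSobolevNorm μ ρ 0 = 0 :=
      le_antisymm ((homSobolevNorm_le hgrad).trans h0.le) zero_le
    have hmem : (0 : Ω → ℝ) ∈ sobolevSpace μ ρ :=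
      ⟨⟨⟨0, 0, MemLp.zero, MemLp.zero, by simp⟩, by simp [hH]⟩, aemeasurable_const, by simp [h0]⟩
    refine (KFunctional_le t hfX hmem (by simp)).trans ?_
    rw [sobolevNorm, hH, h0, min_eq_left h1, ENNReal.ofReal_one, one_mul, add_zero, mul_zero,
      add_zero, two_mul]
    exact le_add_left (le_add_left le_rfl)
  · rw [min_eq_right h1]
    refine le_mul_KFunctional_add (C := 2) two_pos fun f₀ hf₀ f₁ hf₁ hsum => ?_
    have hf₁m : AEMeasurable f₁ μ := L1AddLinf_aemeasurable hf₁.1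
    have hN : fnNorm ρ f₁ ≤ fnNorm ρ f + fnNorm ρ f₀ := by
      have h2 : f₁ =ᵐ[μ] f + -f₀ := by
        filter_upwards [hsum] with x hx
        simp [hx]
      have h3 : fnNorm ρ (-f₀) = fnNorm ρ f₀ := by simp [fnNorm]
      exact (hρ.fnNorm_le_add hf hf₀.1.neg h2).trans_eq (by rw [h3])
    have hmem : f₁ ∈ sobolevSpace μ ρ :=
      ⟨hf₁, hf₁m, hN.trans_lt (ENNReal.add_lt_top.2 ⟨hfX.2, hf₀.2⟩)⟩
    refine (KFunctional_le t hf₀ hmem hsum).trans ?_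
    have ht1 : ENNReal.ofReal t * fnNorm ρ f₀ ≤ fnNorm ρ f₀ :=
      mul_le_of_le_one_left' (ENNReal.ofReal_le_one.2 h1)
    rw [sobolevNorm]
    calc fnNorm ρ f₀ + ENNReal.ofReal t * (fnNorm ρ f₁ + homSobolevNorm μ ρ f₁)
        ≤ fnNorm ρ f₀ + ENNReal.ofReal t *
            (fnNorm ρ f + fnNorm ρ f₀ + homSobolevNorm μ ρ f₁) := by gcongr
      _ = fnNorm ρ f₀ + ENNReal.ofReal t * fnNorm ρ f₀ + (ENNReal.ofReal t * fnNorm ρ f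
            + ENNReal.ofReal t * homSobolevNorm μ ρ f₁) := by ring
      _ ≤ fnNorm ρ f₀ + fnNorm ρ f₀ + 2 * (ENNReal.ofReal t * fnNorm ρ f
            + ENNReal.ofReal t * homSobolevNorm μ ρ f₁) := by
          gcongr
          exact le_mul_of_one_le_left' one_le_two
      _ = _ := by push_cast; ring

/-- Comparison of the two couples, lower bound for the inhomogeneous `K`-functional. -/
theorem IsRearrangementInvariantNorm.homK_add_le (hρ : IsRearrangementInvariantNorm μ ρ)
    {f : Ω → ℝ} {t : ℝ} :
    homK μ ρ f t + ENNReal.ofReal (min 1 t) * fnNorm ρ f ≤ 2 * inhomK μ ρ f t := by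
  rw [← add_zero (inhomK μ ρ f t)]
  refine le_mul_KFunctional_add (C := 2) two_pos fun f₀ hf₀ f₁ hf₁ hsum => ?_
  have h1 : homK μ ρ f t ≤ _ := KFunctional_le t hf₀ hf₁.1 hsum
  have h2 := hρ.fnNorm_le_add hf₀.1 hf₁.2.1 hsum
  have h3 : ENNReal.ofReal (min 1 t) * fnNorm ρ f₀ ≤ fnNorm ρ f₀ :=
    mul_le_of_le_one_left' (ENNReal.ofReal_le_one.2 (min_le_left _ _))
  have h4 : ENNReal.ofReal (min 1 t) ≤ ENNReal.ofReal t :=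
    ENNReal.ofReal_le_ofReal (min_le_right _ _)
  rw [sobolevNorm]
  calc homK μ ρ f t + ENNReal.ofReal (min 1 t) * fnNorm ρ f
      ≤ (fnNorm ρ f₀ + ENNReal.ofReal t * homSobolevNorm μ ρ f₁) +
          ENNReal.ofReal (min 1 t) * (fnNorm ρ f₀ + fnNorm ρ f₁) := by gcongr
    _ ≤ (fnNorm ρ f₀ + ENNReal.ofReal t * homSobolevNorm μ ρ f₁) +
          (fnNorm ρ f₀ + ENNReal.ofReal t * fnNorm ρ f₁) := by
        rw [mul_add]
        gcongr
    _ ≤ (fnNorm ρ f₀ + ENNReal.ofReal t * homSobolevNorm μ ρ f₁) +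
          (fnNorm ρ f₀ + ENNReal.ofReal t * fnNorm ρ f₁) +
          (ENNReal.ofReal t * homSobolevNorm μ ρ f₁ + ENNReal.ofReal t * fnNorm ρ f₁) :=
        le_self_add
    _ = _ := by push_cast; ring

/-! ### The moduli are dominated by the `K`-functional -/

section Borel

variable [BorelSpace Ω] [SecondCountableTopology Ω] [SFinite μ]

theorem aemeasurable_setLAverage_enorm_sub {f : Ω → ℝ} (hf : AEMeasurable f μ) (q t : ℝ) :
    AEMeasurable (fun x => ⨍⁻ y in Metric.ball x t, ‖f x - f y‖ₑ ^ q ∂μ) μ := by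
  have h : Measurable fun x => ⨍⁻ y in Metric.ball x t, ‖hf.mk f x - hf.mk f y‖ₑ ^ q ∂μ :=
    measurable_setLAverage_ball (F := fun x y => ‖hf.mk f x - hf.mk f y‖ₑ ^ q)
      (((hf.measurable_mk.comp measurable_fst).sub
        (hf.measurable_mk.comp measurable_snd)).enorm.pow_const q) t
  refine h.aemeasurable.congr ?_
  filter_upwards [hf.ae_eq_mk] with x hx
  refine laverage_congr (ae_restrict_of_ae ?_)
  filter_upwards [hf.ae_eq_mk] with y hy
  rw [hx, hy]

theorem aemeasurable_setLAverage_enorm_sub_one {f : Ω → ℝ} (hf : AEMeasurable f μ) (t : ℝ) :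
    AEMeasurable (fun x => ⨍⁻ y in Metric.ball x t, ‖f x - f y‖ₑ ∂μ) μ := by
  simpa using aemeasurable_setLAverage_enorm_sub hf 1 t

theorem IsRearrangementInvariantNorm.modulus_le_pModulus
    (hρ : IsRearrangementInvariantNorm μ ρ) (hμ : IsRDSpace μ) {p : ℝ} (hp : 1 ≤ p) {f : Ω → ℝ}
    (hf : AEMeasurable f μ) {t : ℝ} (ht : 0 < t) : modulus μ ρ f t ≤ pModulus μ p ρ f t := by
  refine hρ.mono _ _ (aemeasurable_setLAverage_enorm_sub_one hf t)
    ((aemeasurable_setLAverage_enorm_sub hf p t).pow_const _)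
    (Filter.Eventually.of_forall fun x => ?_)
  rw [one_div, ENNReal.le_rpow_inv_iff (zero_lt_one.trans_le hp)]
  exact setLAverage_rpow_le (hμ.ball_finite x t ht).ne hp (hf.const_sub _).enorm

/-- If the differences of `f` at distance less than `t` are bounded by the sums of the values of
`h`, then the modulus at scale `t` is bounded by the norm of `h`, by the boundedness of the
averaging operators applied to `h ^ p`. -/
theorem IsRearrangementInvariantNorm.exists_pModulus_le
    (hρ : IsRearrangementInvariantNorm μ ρ) (hμ : IsRDSpace μ) {p : ℝ} (hp : 1 ≤ p) :
    ∃ C : ℝ≥0, 0 < C ∧ ∀ (t : ℝ) (f : Ω → ℝ) (h : Ω → ℝ≥0∞), 0 < t → AEMeasurable f μ →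
      AEMeasurable h μ →
      (∃ N, μ N = 0 ∧ ∀ x ∉ N, ∀ y ∉ N, dist x y < t → ‖f x - f y‖ₑ ≤ h x + h y) →
      pModulus μ p (convexification p ρ) f t ≤ C * convexification p ρ h := by
  have hp0 : 0 < p := zero_lt_one.trans_le hp
  obtain ⟨C, hC⟩ := hρ.exists_average_le hμ
  set L : ℝ≥0 := 2 ^ (p - 1) with hL
  have hL2 : (2 : ℝ≥0∞) ^ (p - 1) = (L : ℝ≥0∞) := by
    rw [hL, ENNReal.coe_rpow_of_nonneg _ (sub_nonneg.2 hp)]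
    rfl
  have hL1 : 1 ≤ L := NNReal.one_le_rpow one_le_two (sub_nonneg.2 hp)
  have hC1 : 1 ≤ L * (1 + C) := one_le_mul_of_one_le_of_one_le hL1 le_self_add
  refine ⟨L * (1 + C), zero_lt_one.trans_le hC1, fun t f h ht hf hh ⟨N, hN, hNle⟩ => ?_⟩
  rw [pModulus, convexification_le_iff hp0]
  have hG : ∀ x, ((⨍⁻ y in Metric.ball x t, ‖f x - f y‖ₑ ^ p ∂μ) ^ (1 / p)) ^ p =
      ⨍⁻ y in Metric.ball x t, ‖f x - f y‖ₑ ^ p ∂μ := fun x => by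
    rw [← ENNReal.rpow_mul, one_div_mul_cancel hp0.ne', ENNReal.rpow_one]
  simp only [hG]
  have hhp : AEMeasurable (fun x => h x ^ p) μ := hh.pow_const p
  have hav : AEMeasurable (fun x => ⨍⁻ y in Metric.ball x t, h y ^ p ∂μ) μ := by
    have : ∀ x, ⨍⁻ y in Metric.ball x t, h y ^ p ∂μ = ⨍⁻ y in Metric.ball x t, hhp.mk _ y ∂μ :=
      fun x => laverage_congr (ae_restrict_of_ae hhp.ae_eq_mk)
    simp only [this]
    exact (measurable_setLAverage_ball (F := fun _ y => hhp.mk _ y)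
      (hhp.measurable_mk.comp measurable_snd) t).aemeasurable
  have hpt : ∀ᵐ x ∂μ, ⨍⁻ y in Metric.ball x t, ‖f x - f y‖ₑ ^ p ∂μ ≤
      L * (h x ^ p + ⨍⁻ y in Metric.ball x t, h y ^ p ∂μ) := by
    have hNae : ∀ᵐ x ∂μ, x ∉ N := measure_eq_zero_iff_ae_notMem.1 hN
    filter_upwards [hNae] with x hx
    have hB0 := (hμ.ball_pos x t ht).ne'
    have hBt := (hμ.ball_finite x t ht).ne
    have h1 : ∫⁻ y in Metric.ball x t, ‖f x - f y‖ₑ ^ p ∂μ ≤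
        ∫⁻ y in Metric.ball x t, L * (h x ^ p + h y ^ p) ∂μ := by
      refine lintegral_mono_ae ?_
      filter_upwards [ae_restrict_of_ae hNae, ae_restrict_mem measurableSet_ball] with y hy hyB
      rw [← hL2]
      refine (ENNReal.rpow_le_rpow (hNle x hx y hy ?_) hp0.le).trans
        (ENNReal.rpow_add_le_mul_rpow_add_rpow _ _ hp)
      rw [dist_comm]
      exact hyB
    rw [setLAverage_eq, setLAverage_eq]
    refine (ENNReal.div_le_div_right h1 _).trans (le_of_eq ?_)
    rw [lintegral_const_mul'' _ (hhp.restrict.const_add _), lintegral_add_left' aemeasurable_const,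
      setLIntegral_const, mul_div_assoc, ENNReal.add_div, mul_div_assoc, ENNReal.div_self hB0 hBt,
      mul_one]
  calc (ρ fun x => ⨍⁻ y in Metric.ball x t, ‖f x - f y‖ₑ ^ p ∂μ)
      ≤ ρ fun x => L * (h x ^ p + ⨍⁻ y in Metric.ball x t, h y ^ p ∂μ) :=
        hρ.mono _ _ (aemeasurable_setLAverage_enorm_sub hf p t)
          ((hhp.add hav).const_mul _) hpt
    _ = L * ρ fun x => h x ^ p + ⨍⁻ y in Metric.ball x t, h y ^ p ∂μ :=
        hρ.homogeneous L _ (hhp.add hav)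
    _ ≤ L * ((ρ fun x => h x ^ p) + C * ρ fun x => h x ^ p) :=
        mul_le_mul_right ((hρ.triangle _ _ hhp hav).trans (add_le_add le_rfl (hC t ht _ hhp))) _
    _ = ((L * (1 + C) : ℝ≥0) : ℝ≥0∞) * convexification p ρ h ^ p := by
        rw [convexification_rpow hp0]; push_cast; ring
    _ ≤ ((L * (1 + C) : ℝ≥0) : ℝ≥0∞) ^ p * convexification p ρ h ^ p := by
        refine mul_le_mul_left ?_ _
        conv_lhs => rw [← ENNReal.rpow_one ((L * (1 + C) : ℝ≥0) : ℝ≥0∞)]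
        exact ENNReal.rpow_le_rpow_of_exponent_le (by exact_mod_cast hC1) hp
    _ = _ := (ENNReal.mul_rpow_of_nonneg _ _ hp0.le).symm

theorem IsRearrangementInvariantNorm.exists_pModulus_le_homK
    (hρ : IsRearrangementInvariantNorm μ ρ) (hμ : IsRDSpace μ) {p : ℝ} (hp : 1 ≤ p) :
    ∃ C : ℝ≥0, 0 < C ∧ ∀ (f : Ω → ℝ), AEMeasurable f μ → ∀ t : ℝ, 0 < t →
      pModulus μ p (convexification p ρ) f t
        ≤ C * homK μ (convexification p ρ) f t := by
  obtain ⟨C, hC0, hC⟩ := hρ.exists_pModulus_le hμ hp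
  have hX := isRearrangementInvariantNorm_convexification hρ hp
  refine ⟨C, hC0, fun f hf t ht => le_mul_homK ht hC0 fun f₀ hf₀ f₁ hsum g hg => ?_⟩
  obtain ⟨hgm, hg0, N, hN, hNle⟩ := hg
  have hm : AEMeasurable (fun x => ENNReal.ofReal t * ‖g x‖ₑ) μ := hgm.enorm.const_mul _
  -- At distance less than `t`, the `1`-gradient `g` of `f₁` acts as the bounding function `t * g`.
  refine (hC t f (fun x => ‖f₀ x‖ₑ + ENNReal.ofReal t * ‖g x‖ₑ) ht hf (hf₀.1.enorm.add hm)
    ⟨N ∪ {x | f x ≠ (f₀ + f₁) x}, ?_, ?_⟩).trans (mul_le_mul_right ?_ _)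
  · rw [measure_union_null_iff]
    exact ⟨hN, hsum⟩
  · intro x hx y hy hxy
    simp only [Set.mem_union, Set.mem_ofPred_eq, not_or, not_not, Pi.add_apply] at hx hy
    have h1 : ‖f₁ x - f₁ y‖ₑ ≤ ENNReal.ofReal t * ‖g x‖ₑ + ENNReal.ofReal t * ‖g y‖ₑ := by
      rw [← mul_add, Real.enorm_eq_ofReal (hg0 x), Real.enorm_eq_ofReal (hg0 y),
        ← ENNReal.ofReal_add (hg0 x) (hg0 y), ← ENNReal.ofReal_mul ht.le, ← ofReal_norm]
      refine ENNReal.ofReal_le_ofReal ((hNle x hx.1 y hy.1).trans ?_)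
      exact mul_le_mul_of_nonneg_right hxy.le (add_nonneg (hg0 x) (hg0 y))
    calc ‖f x - f y‖ₑ = ‖(f₀ x - f₀ y) + (f₁ x - f₁ y)‖ₑ := by
          rw [hx.2, hy.2]; congr 1; ring
      _ ≤ ‖f₀ x - f₀ y‖ₑ + ‖f₁ x - f₁ y‖ₑ := enorm_add_le _ _
      _ ≤ (‖f₀ x‖ₑ + ‖f₀ y‖ₑ) + (ENNReal.ofReal t * ‖g x‖ₑ + ENNReal.ofReal t * ‖g y‖ₑ) :=
          add_le_add enorm_sub_le h1
      _ = _ := by ring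
  · refine (hX.triangle _ _ hf₀.1.enorm hm).trans (add_le_add le_rfl ?_)
    exact (hX.const_mul ENNReal.ofReal_ne_top hgm.enorm).le

end Borel

end Modulus

/-! ### Smoothing at a given scale -/

section Tent

variable {Ω : Type*} [MetricSpace Ω]

/-- The tent of height `2` and radius `2 * t` centred at `x`. -/
noncomputable def tent (t : ℝ) (x z : Ω) : ℝ := max 0 (2 - dist x z / t)

theorem tent_nonneg (t : ℝ) (x z : Ω) : 0 ≤ tent t x z := le_max_left _ _

theorem tent_le_two {t : ℝ} (ht : 0 < t) (x z : Ω) : tent t x z ≤ 2 :=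
  max_le zero_le_two (sub_le_self _ (by positivity))

theorem norm_tent_le {t : ℝ} (ht : 0 < t) (x z : Ω) : ‖tent t x z‖ ≤ 2 := by
  rw [Real.norm_of_nonneg (tent_nonneg t x z)]
  exact tent_le_two ht x z

theorem one_le_tent {t : ℝ} (ht : 0 < t) {x z : Ω} (h : dist x z ≤ t) : 1 ≤ tent t x z := by
  refine le_max_of_le_right ?_
  have := (div_le_one ht).2 h
  linarith

theorem tent_eq_zero {t : ℝ} (ht : 0 < t) {x z : Ω} (h : 2 * t ≤ dist x z) : tent t x z = 0 := by
  refine max_eq_left ?_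
  have := (le_div_iff₀ ht).2 h
  linarith

theorem abs_tent_sub_tent_le {t : ℝ} (ht : 0 < t) (x y z : Ω) :
    |tent t x z - tent t y z| ≤ dist x y / t := by
  refine (abs_max_sub_max_le_max (0 : ℝ) _ 0 _).trans (max_le ?_ ?_)
  · rw [sub_self, abs_zero]; positivity
  · rw [sub_sub_sub_cancel_left, ← sub_div, abs_div, abs_of_pos ht, dist_comm x y]
    gcongr
    exact abs_dist_sub_le y x z

theorem continuous_tent (t : ℝ) : Continuous fun q : Ω × Ω => tent t q.1 q.2 :=
  continuous_const.max (continuous_const.sub ((continuous_fst.dist continuous_snd).div_const t))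

end Tent

/-- The average of `f` against the tent of scale `t` centred at `x`. -/
noncomputable def mollify {Ω : Type*} [MetricSpace Ω] [MeasurableSpace Ω] (μ : Measure Ω)
    (f : Ω → ℝ) (t : ℝ) (x : Ω) : ℝ :=
  (∫ z, tent t x z * f z ∂μ) / ∫ z, tent t x z ∂μ

theorem abs_div_sub_div_le {F₁ F₂ w₁ w₂ I V D ε : ℝ} (hI : 0 ≤ I) (hV : 0 < V) (hD : 0 < D)
    (hε : 0 ≤ ε) (hF₁ : |F₁| ≤ 2 * I) (hF : |F₁ - F₂| ≤ ε * I) (hw : |w₁ - w₂| ≤ ε * V)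
    (hw₁ : V ≤ D * w₁) (hw₂ : V ≤ D * w₂) :
    |F₁ / w₁ - F₂ / w₂| ≤ ε * (2 * D ^ 2 + D) * (I / V) := by
  have h₁ : 0 < w₁ := pos_of_mul_pos_right (hV.trans_le hw₁) hD.le
  have h₂ : 0 < w₂ := pos_of_mul_pos_right (hV.trans_le hw₂) hD.le
  have i₁ : 1 / w₁ ≤ D / V := by rw [div_le_div_iff₀ h₁ hV]; linarith
  have i₂ : 1 / w₂ ≤ D / V := by rw [div_le_div_iff₀ h₂ hV]; linarith
  have heq : F₁ / w₁ - F₂ / w₂ = -(F₁ * (w₁ - w₂) * (1 / w₁) * (1 / w₂))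
      + (F₁ - F₂) * (1 / w₂) := by
    field_simp; ring
  have n₁ : 0 ≤ 1 / w₁ := by positivity
  have n₂ : 0 ≤ 1 / w₂ := by positivity
  rw [heq]
  refine (abs_add_le _ _).trans ?_
  rw [abs_neg, abs_mul, abs_mul, abs_mul, abs_mul, abs_of_nonneg n₁, abs_of_nonneg n₂]
  calc |F₁| * |w₁ - w₂| * (1 / w₁) * (1 / w₂) + |F₁ - F₂| * (1 / w₂)
      ≤ (2 * I) * (ε * V) * (D / V) * (D / V) + (ε * I) * (D / V) := by gcongr
    _ = _ := by field_simp

theorem aestronglyMeasurable_tent {Ω : Type*} [MetricSpace Ω] [MeasurableSpace Ω] [BorelSpace Ω]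
    (t : ℝ) (u : Ω) (ν : Measure Ω) :
    AEStronglyMeasurable (fun z => tent t u z) ν :=
  ((continuous_tent t).comp (Continuous.prodMk_right u)).aestronglyMeasurable

theorem setIntegral_tent_mul {Ω : Type*} [MetricSpace Ω] [MeasurableSpace Ω] {μ : Measure Ω}
    {t : ℝ} (ht : 0 < t) {x u : Ω} (hu : dist x u < t) (φ : Ω → ℝ) :
    ∫ z in Metric.ball x (4 * t), tent t u z * φ z ∂μ = ∫ z, tent t u z * φ z ∂μ := by
  refine setIntegral_eq_integral_of_forall_compl_eq_zero fun z hz => ?_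
  rw [tent_eq_zero ht, zero_mul]
  rw [Metric.mem_ball, not_lt] at hz
  have := dist_triangle z u x
  rw [dist_comm u x, dist_comm z u] at this
  linarith

/-- The mass of a tent is comparable with the measure of the surrounding ball. -/
theorem measureReal_ball_le_mul_integral_tent {Ω : Type*} [MetricSpace Ω] [MeasurableSpace Ω]
    [BorelSpace Ω] {μ : Measure Ω} (hμ : IsRDSpace μ) {D : ℝ≥0}
    (hD : ∀ (x : Ω) (r : ℝ), 0 < r → μ (Metric.ball x (5 * r)) ≤ D * μ (Metric.ball x r))
    {t : ℝ} (ht : 0 < t) {x u : Ω} (hu : dist x u < t) :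
    μ.real (Metric.ball x (4 * t)) ≤ D * ∫ z, tent t u z ∂μ := by
  have hBt : ∀ (y : Ω) (r : ℝ), 0 < r → μ (Metric.ball y r) ≠ ∞ := fun y r hr =>
    (hμ.ball_finite y r hr).ne
  have h1 : μ.real (Metric.ball x (4 * t)) ≤ D * μ.real (Metric.ball u t) := by
    have : μ (Metric.ball x (4 * t)) ≤ D * μ (Metric.ball u t) :=
      (measure_mono (Metric.ball_subset_ball' (by linarith))).trans (hD u t ht)
    have h2 := ENNReal.toReal_mono (ENNReal.mul_ne_top ENNReal.coe_ne_top (hBt u t ht)) this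
    rwa [ENNReal.toReal_mul, ENNReal.coe_toReal] at h2
  refine h1.trans (mul_le_mul_of_nonneg_left ?_ D.coe_nonneg)
  have h3 := setIntegral_tent_mul (μ := μ) ht hu fun _ => 1
  simp only [mul_one] at h3
  have hfin : IsFiniteMeasure (μ.restrict (Metric.ball x (4 * t))) :=
    ⟨by rw [Measure.restrict_apply_univ]; exact (hBt _ _ (by positivity)).lt_top⟩
  have hint : Integrable (fun z => tent t u z) (μ.restrict (Metric.ball x (4 * t))) :=
    Integrable.of_bound (aestronglyMeasurable_tent t u _) 2
      (Filter.Eventually.of_forall (norm_tent_le ht u))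
  have hsub : Metric.ball u t ⊆ Metric.ball x (4 * t) :=
    Metric.ball_subset_ball' (by rw [dist_comm]; linarith)
  rw [← h3]
  calc μ.real (Metric.ball u t) = ∫ z in Metric.ball u t, (1 : ℝ) ∂μ := by simp
    _ ≤ ∫ z in Metric.ball u t, tent t u z ∂μ := by
        refine setIntegral_mono_on (integrableOn_const (hBt u t ht))
          (IntegrableOn.mono_set hint hsub) measurableSet_ball fun z hz => one_le_tent ht ?_
        rw [dist_comm]
        exact (Metric.mem_ball.1 hz).le
    _ ≤ ∫ z in Metric.ball x (4 * t), tent t u z ∂μ :=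
        setIntegral_mono_set hint (Filter.Eventually.of_forall fun z => tent_nonneg t u z)
          hsub.eventuallyLE

section Mollify

variable {Ω : Type*} [MetricSpace Ω] [MeasurableSpace Ω] [BorelSpace Ω]
  {μ : Measure Ω}

theorem measurable_mollify [SecondCountableTopology Ω] [SFinite μ] {f : Ω → ℝ}
    (hf : Measurable f) (t : ℝ) : Measurable (mollify μ f t) := by
  have h1 : Measurable fun q : Ω × Ω => tent t q.1 q.2 := (continuous_tent t).measurable
  have h2 := (StronglyMeasurable.integral_prod_right (ν := μ)
    (f := fun x z : Ω => tent t x z) h1.stronglyMeasurable).measurable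
  have h3 := (StronglyMeasurable.integral_prod_right (ν := μ)
    (f := fun x z : Ω => tent t x z * f z)
    (h1.mul (hf.comp measurable_snd)).stronglyMeasurable).measurable
  exact h3.div h2

/-- The two local estimates for the smoothing: its distance from `f x`, and its Lipschitz estimate
near `x`, are controlled by the mean oscillation of `f` around the value `f x` on one ball. -/
theorem mollify_local (hμ : IsRDSpace μ) {D : ℝ≥0} (hD1 : 1 ≤ D)
    (hD : ∀ (x : Ω) (r : ℝ), 0 < r → μ (Metric.ball x (5 * r)) ≤ D * μ (Metric.ball x r))
    {f : Ω → ℝ} (hf : Measurable f)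
    (hloc : ∀ (x : Ω) (r : ℝ), 0 < r → ∫⁻ z in Metric.ball x r, ‖f z‖ₑ ∂μ < ∞)
    {t : ℝ} (ht : 0 < t) (x : Ω) :
    ‖mollify μ f t x - f x‖ₑ
        ≤ (2 * D : ℝ≥0) * ⨍⁻ z in Metric.ball x (4 * t), ‖f x - f z‖ₑ ∂μ ∧
      ∀ y, dist x y < t → ‖mollify μ f t x - mollify μ f t y‖ₑ ≤ ENNReal.ofReal (dist x y / t) *
        ((2 * D ^ 2 + D : ℝ≥0) * ⨍⁻ z in Metric.ball x (4 * t), ‖f x - f z‖ₑ ∂μ) := by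
  set B := Metric.ball x (4 * t) with hB
  have hBt : μ B ≠ ∞ := (hμ.ball_finite x (4 * t) (by positivity)).ne
  have hB0 : 0 < μ.real B := ENNReal.toReal_pos (hμ.ball_pos x (4 * t) (by positivity)).ne' hBt
  have hD0 : (0 : ℝ) < D := by exact_mod_cast zero_lt_one.trans_le hD1
  have hfin : IsFiniteMeasure (μ.restrict B) :=
    ⟨by rw [Measure.restrict_apply_univ]; exact hBt.lt_top⟩
  have hfB : Integrable f (μ.restrict B) :=
    ⟨hf.aestronglyMeasurable, hloc x (4 * t) (by positivity)⟩
  have hφ : Integrable (fun z => f z - f x) (μ.restrict B) := hfB.sub (integrable_const _)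
  have hφn : Integrable (fun z => ‖f x - f z‖) (μ.restrict B) :=
    ((integrable_const _).sub hfB).norm
  set I := ∫ z in B, ‖f x - f z‖ ∂μ with hI
  have hI0 : 0 ≤ I := integral_nonneg fun z => norm_nonneg _
  have hav : ⨍⁻ z in B, ‖f x - f z‖ₑ ∂μ = ENNReal.ofReal (I / μ.real B) := by
    rw [ENNReal.ofReal_div_of_pos hB0, hI,
      ofReal_integral_norm_eq_lintegral_enorm
        (f := fun z => f x - f z) ((integrable_const _).sub hfB), setLAverage_eq,
      ofReal_measureReal hBt]
  have htent : ∀ u, Integrable (fun z => tent t u z) (μ.restrict B) := fun u =>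
    Integrable.of_bound (aestronglyMeasurable_tent t u _) 2
      (Filter.Eventually.of_forall (norm_tent_le ht u))
  have hmul : ∀ u, ∀ φ : Ω → ℝ, Integrable φ (μ.restrict B) →
      Integrable (fun z => tent t u z * φ z) (μ.restrict B) := fun u φ hφ =>
    hφ.bdd_mul (aestronglyMeasurable_tent t u _) (Filter.Eventually.of_forall (norm_tent_le ht u))
  -- On `B`, which contains the supports of all tents involved, the smoothing minus `f x` is `F / w`.
  set w : Ω → ℝ := fun u => ∫ z in B, tent t u z ∂μ with hw
  set F : Ω → ℝ := fun u => ∫ z in B, tent t u z * (f z - f x) ∂μ with hF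
  have hwle : ∀ u, dist x u < t → μ.real B ≤ D * w u := by
    intro u hu
    have h3 := setIntegral_tent_mul (μ := μ) ht hu fun _ => 1
    simp only [mul_one] at h3
    rw [hw]
    simp only
    rw [h3]
    exact measureReal_ball_le_mul_integral_tent hμ hD ht hu
  have hwpos : ∀ u, dist x u < t → 0 < w u := fun u hu =>
    pos_of_mul_pos_right (hB0.trans_le (hwle u hu)) hD0.le
  have hmol : ∀ u, dist x u < t → mollify μ f t u - f x = F u / w u := by
    intro u hu
    have h3 := setIntegral_tent_mul (μ := μ) ht hu fun _ => 1
    simp only [mul_one] at h3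
    have h4 : F u = (∫ z in B, tent t u z * f z ∂μ) - w u * f x := by
      rw [hF, hw]
      simp only [mul_sub]
      rw [integral_sub (hmul u f hfB) ((htent u).mul_const _), integral_mul_const]
    rw [mollify, ← setIntegral_tent_mul ht hu, ← h3, h4, sub_div,
      mul_div_cancel_left₀ _ (hwpos u hu).ne']
  have hFle : ∀ u, |F u| ≤ 2 * I := by
    intro u
    rw [hI, ← integral_const_mul, ← Real.norm_eq_abs]
    refine norm_integral_le_of_norm_le (hφn.const_mul 2) (Filter.Eventually.of_forall fun z => ?_)
    rw [norm_mul, norm_sub_rev (f z)]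
    exact mul_le_mul_of_nonneg_right (norm_tent_le ht u z) (norm_nonneg _)
  have hFsub : ∀ y, |F x - F y| ≤ dist x y / t * I := by
    intro y
    rw [hI, ← integral_const_mul, hF]
    simp only
    rw [← integral_sub (hmul x _ hφ) (hmul y _ hφ), ← Real.norm_eq_abs]
    refine norm_integral_le_of_norm_le (hφn.const_mul _) (Filter.Eventually.of_forall fun z => ?_)
    rw [← sub_mul, norm_mul, norm_sub_rev (f z)]
    exact mul_le_mul_of_nonneg_right (abs_tent_sub_tent_le ht x y z) (norm_nonneg _)
  have hwsub : ∀ y, |w x - w y| ≤ dist x y / t * μ.real B := by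
    intro y
    rw [hw]
    simp only
    rw [← integral_sub (htent x) (htent y), ← Real.norm_eq_abs]
    refine (norm_integral_le_of_norm_le (g := fun _ => dist x y / t) (integrable_const _)
      (Filter.Eventually.of_forall fun z =>
        (Real.norm_eq_abs _).trans_le (abs_tent_sub_tent_le ht x y z))).trans_eq ?_
    rw [setIntegral_const, smul_eq_mul, mul_comm]
  have hxx : dist x x < t := by rwa [dist_self]
  refine ⟨?_, fun y hy => ?_⟩
  · rw [hmol x hxx, hav, ← ofReal_norm, ← ENNReal.ofReal_coe_nnreal,
      ← ENNReal.ofReal_mul (NNReal.coe_nonneg _)]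
    refine ENNReal.ofReal_le_ofReal ?_
    rw [norm_div, Real.norm_of_nonneg (hwpos x hxx).le, ← mul_div_assoc,
      div_le_div_iff₀ (hwpos x hxx) hB0]
    push_cast
    calc ‖F x‖ * μ.real B ≤ (2 * I) * (D * w x) :=
          mul_le_mul (hFle x) (hwle x hxx) hB0.le (by positivity)
      _ = _ := by ring
  · have h5 : mollify μ f t x - mollify μ f t y = F x / w x - F y / w y := by
      rw [← hmol x hxx, ← hmol y hy]; ring
    have hε : 0 ≤ dist x y / t := by positivity
    rw [h5, hav, ← ofReal_norm, ← ENNReal.ofReal_coe_nnreal,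
      ← ENNReal.ofReal_mul (NNReal.coe_nonneg _), ← ENNReal.ofReal_mul hε]
    refine ENNReal.ofReal_le_ofReal ((abs_div_sub_div_le hI0 hB0 hD0 hε (hFle x) (hFsub y)
      (hwsub y) (hwle x hxx) (hwle y hy)).trans_eq ?_)
    push_cast
    ring

end Mollify

/-- At distance less than `r`, the difference of two values of `f` is controlled by mean
oscillations around each of them. -/
theorem enorm_sub_le_setLAverage_add {Ω : Type*} [MetricSpace Ω] [MeasurableSpace Ω]
    {μ : Measure Ω} (hμ : IsRDSpace μ) {D : ℝ≥0} (hD1 : 1 ≤ D)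
    (hD : ∀ (x : Ω) (r : ℝ), 0 < r → μ (Metric.ball x (5 * r)) ≤ D * μ (Metric.ball x r))
    {f : Ω → ℝ} (hf : Measurable f) {r : ℝ} {x y : Ω} (h : dist x y < r) :
    ‖f x - f y‖ₑ ≤ ⨍⁻ z in Metric.ball x r, ‖f x - f z‖ₑ ∂μ +
      D * ⨍⁻ z in Metric.ball y (2 * r), ‖f y - f z‖ₑ ∂μ := by
  have hr : 0 < r := dist_nonneg.trans_lt h
  have hB0 := (hμ.ball_pos x r hr).ne'
  have hBt := (hμ.ball_finite x r hr).ne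
  have h1 : ⨍⁻ z in Metric.ball x r, ‖f y - f z‖ₑ ∂μ ≤
      D * ⨍⁻ z in Metric.ball y (2 * r), ‖f y - f z‖ₑ ∂μ := by
    refine setLAverage_le_mul_of_subset (Metric.ball_subset_ball' (by linarith)) hD1 ?_ _
    refine (measure_mono (Metric.ball_subset_ball' ?_)).trans (hD x r hr)
    rw [dist_comm]
    linarith
  refine le_trans ?_ (add_le_add le_rfl h1)
  rw [setLAverage_eq, setLAverage_eq, ← ENNReal.add_div,
    ← lintegral_add_left (hf.const_sub _).enorm, ENNReal.le_div_iff_mul_le (Or.inl hB0)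
      (Or.inl hBt), ← setLIntegral_const]
  refine lintegral_mono fun z => ?_
  calc ‖f x - f y‖ₑ = ‖(f x - f z) - (f y - f z)‖ₑ := by rw [sub_sub_sub_cancel_right]
    _ ≤ _ := enorm_sub_le

/-! ### The `K`-functional is dominated by the moduli -/

section Decomposition

variable {Ω : Type*} [MetricSpace Ω] [MeasurableSpace Ω] {μ : Measure Ω}

/-- The dyadic sum of mean oscillations at scales `2 ^ j * t`. Up to a factor it is a `1`-gradient
of the smoothing of `f` at scale `t`. -/
noncomputable def oscillationSum (μ : Measure Ω) (f : Ω → ℝ) (t : ℝ)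
    (x : Ω) : ℝ≥0∞ :=
  ∑' j : ℕ, (2⁻¹ : ℝ≥0∞) ^ j * ⨍⁻ y in Metric.ball x (2 ^ j * t), ‖f x - f y‖ₑ ∂μ

theorem setLAverage_le_oscillationSum (f : Ω → ℝ) (t : ℝ) (x : Ω) (j : ℕ) :
    ⨍⁻ y in Metric.ball x (2 ^ j * t), ‖f x - f y‖ₑ ∂μ ≤ 2 ^ j * oscillationSum μ f t x := by
  have h := ENNReal.le_tsum (f := fun j : ℕ => (2⁻¹ : ℝ≥0∞) ^ j *
    ⨍⁻ y in Metric.ball x (2 ^ j * t), ‖f x - f y‖ₑ ∂μ) j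
  refine le_trans (le_of_eq ?_) (mul_le_mul_right h _)
  rw [← mul_assoc, ← mul_pow, ENNReal.mul_inv_cancel two_ne_zero ENNReal.ofNat_ne_top, one_pow,
    one_mul]

/-- The Hajłasz inequality for the smoothing. At distances less than `t` it is the local Lipschitz
estimate; at distances comparable with `2 ^ j * t` the smoothing is replaced by `f` itself, and the
oscillations at that scale are compared with the distance. -/
theorem enorm_mollify_sub_le [BorelSpace Ω] (hμ : IsRDSpace μ) {D : ℝ≥0} (hD1 : 1 ≤ D)
    (hD : ∀ (x : Ω) (r : ℝ), 0 < r → μ (Metric.ball x (5 * r)) ≤ D * μ (Metric.ball x r))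
    {f : Ω → ℝ} (hf : Measurable f)
    (hloc : ∀ (x : Ω) (r : ℝ), 0 < r → ∫⁻ z in Metric.ball x r, ‖f z‖ₑ ∂μ < ∞)
    {t : ℝ} (ht : 0 < t) (x y : Ω) :
    ‖mollify μ f t x - mollify μ f t y‖ₑ ≤ ENNReal.ofReal (dist x y / t) *
      ((12 * D ^ 2 : ℝ≥0) * (oscillationSum μ f t x + oscillationSum μ f t y)) := by
  set S := oscillationSum μ f t with hS
  have hosc : ∀ u, ⨍⁻ z in Metric.ball u (4 * t), ‖f u - f z‖ₑ ∂μ ≤ 4 * S u := fun u => by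
    have := setLAverage_le_oscillationSum (μ := μ) f t u 2
    norm_num at this
    exact this
  have hDD : D ≤ D ^ 2 := le_self_pow₀ hD1 two_ne_zero
  have h1D : 1 ≤ D ^ 2 := one_le_pow₀ hD1
  rcases lt_or_ge (dist x y) t with hlt | hge
  · refine ((mollify_local hμ hD1 hD hf hloc ht x).2 y hlt).trans (mul_le_mul_right ?_ _)
    calc ((2 * D ^ 2 + D : ℝ≥0) : ℝ≥0∞) * ⨍⁻ z in Metric.ball x (4 * t), ‖f x - f z‖ₑ ∂μ
        ≤ ((3 * D ^ 2 : ℝ≥0) : ℝ≥0∞) * (4 * S x) := by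
          refine mul_le_mul' (ENNReal.coe_le_coe.2 ?_) (hosc x)
          calc 2 * D ^ 2 + D ≤ 2 * D ^ 2 + D ^ 2 := by gcongr
            _ = 3 * D ^ 2 := by ring
      _ = (12 * D ^ 2 : ℝ≥0) * S x := by push_cast; ring
      _ ≤ _ := mul_le_mul_right le_self_add _
  · set d := dist x y / t with hd
    have hd1 : 1 ≤ d := (one_le_div ht).2 hge
    obtain ⟨j, hj, hj'⟩ := exists_nat_pow_near hd1 (one_lt_two)
    have hxy : dist x y < 2 ^ (j + 1) * t := by rwa [hd, div_lt_iff₀ ht] at hj'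
    have hpow : (2 : ℝ≥0∞) ^ j ≤ ENNReal.ofReal d := by
      have := ENNReal.ofReal_le_ofReal hj
      rwa [ENNReal.ofReal_pow zero_le_two, ENNReal.ofReal_ofNat] at this
    have hone : (1 : ℝ≥0∞) ≤ ENNReal.ofReal d := ENNReal.one_le_ofReal.2 hd1
    have hsm : ∀ u, ‖mollify μ f t u - f u‖ₑ ≤ (2 * D : ℝ≥0) * (4 * S u) := fun u =>
      (mollify_local hμ hD1 hD hf hloc ht u).1.trans (mul_le_mul_right (hosc u) _)
    have hff : ‖f x - f y‖ₑ ≤ 2 ^ (j + 1) * S x + D * (2 ^ (j + 2) * S y) := by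
      refine (enorm_sub_le_setLAverage_add hμ hD1 hD hf hxy).trans (add_le_add
        (setLAverage_le_oscillationSum f t x (j + 1)) (mul_le_mul_right ?_ _))
      have := setLAverage_le_oscillationSum (μ := μ) f t y (j + 2)
      rwa [show (2 : ℝ) ^ (j + 2) * t = 2 * (2 ^ (j + 1) * t) by ring] at this
    have htri : ‖mollify μ f t x - mollify μ f t y‖ₑ ≤
        ‖mollify μ f t x - f x‖ₑ + ‖f x - f y‖ₑ + ‖mollify μ f t y - f y‖ₑ := by
      calc ‖mollify μ f t x - mollify μ f t y‖ₑ
          = ‖((mollify μ f t x - f x) + (f x - f y)) - (mollify μ f t y - f y)‖ₑ := by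
            congr 1; ring
        _ ≤ ‖(mollify μ f t x - f x) + (f x - f y)‖ₑ + ‖mollify μ f t y - f y‖ₑ := enorm_sub_le
        _ ≤ _ := add_le_add (enorm_add_le _ _) le_rfl
    have hDe : (D : ℝ≥0∞) ≤ (D : ℝ≥0∞) ^ 2 := by exact_mod_cast hDD
    have h1e : (1 : ℝ≥0∞) ≤ (D : ℝ≥0∞) ^ 2 := by exact_mod_cast h1D
    have cx : 8 * (D : ℝ≥0∞) + 2 ≤ 12 * (D : ℝ≥0∞) ^ 2 := by
      calc 8 * (D : ℝ≥0∞) + 2 ≤ 8 * (D : ℝ≥0∞) ^ 2 + 2 * (D : ℝ≥0∞) ^ 2 :=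
            add_le_add (mul_le_mul_right hDe _) (le_mul_of_one_le_right' h1e)
        _ = 10 * (D : ℝ≥0∞) ^ 2 := by ring
        _ ≤ _ := by gcongr; norm_num
    have cy : 8 * (D : ℝ≥0∞) + D * 4 ≤ 12 * (D : ℝ≥0∞) ^ 2 := by
      calc 8 * (D : ℝ≥0∞) + D * 4 = 12 * D := by ring
        _ ≤ _ := mul_le_mul_right hDe _
    calc ‖mollify μ f t x - mollify μ f t y‖ₑ
        ≤ (2 * D : ℝ≥0) * (4 * S x) + (2 ^ (j + 1) * S x + D * (2 ^ (j + 2) * S y)) +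
            (2 * D : ℝ≥0) * (4 * S y) :=
          htri.trans (add_le_add (add_le_add (hsm x) hff) (hsm y))
      _ = (8 * D * 1 + 2 * 2 ^ j) * S x + (8 * D * 1 + D * 4 * 2 ^ j) * S y := by
          push_cast; ring
      _ ≤ (8 * D * ENNReal.ofReal d + 2 * ENNReal.ofReal d) * S x +
            (8 * D * ENNReal.ofReal d + D * 4 * ENNReal.ofReal d) * S y := by gcongr
      _ = ENNReal.ofReal d * ((8 * D + 2) * S x + (8 * D + D * 4) * S y) := by ring
      _ ≤ ENNReal.ofReal d * (12 * (D : ℝ≥0∞) ^ 2 * S x + 12 * (D : ℝ≥0∞) ^ 2 * S y) := by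
          gcongr
      _ = _ := by push_cast; ring

/-- The smoothing at scale `t` realises the dyadic sum of moduli as an upper bound for the
`K`-functional. -/
theorem IsRearrangementInvariantNorm.exists_homK_le [BorelSpace Ω]
    {ρ : (Ω → ℝ≥0∞) → ℝ≥0∞}
    (hρ : IsRearrangementInvariantNorm μ ρ) (hμ : IsRDSpace μ) :
    ∃ C : ℝ≥0, 0 < C ∧ ∀ f ∈ L1AddLinf μ, ∀ t : ℝ, 0 < t →
      homK μ ρ f t ≤ C * ∑' j : ℕ, (2⁻¹ : ℝ≥0∞) ^ j * modulus μ ρ f (2 ^ j * t) := by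
  have := hμ.sigmaFinite
  have := hμ.secondCountableTopology
  obtain ⟨D, hD1, hD⟩ := hμ.exists_doubling (l := 5) (by norm_num)
  have hD0 : 0 < D := zero_lt_one.trans_le hD1
  refine ⟨2 * D * 4 + 12 * D ^ 2, by positivity, fun f hfL t ht => ?_⟩
  have hfm := L1AddLinf_aemeasurable hfL
  set f' := hfm.mk f with hf'
  have hf'm : Measurable f' := hfm.measurable_mk
  have heq : f =ᵐ[μ] f' := hfm.ae_eq_mk
  have hf'L : f' ∈ L1AddLinf μ := L1AddLinf_congr hfL heq
  have hloc : ∀ (x : Ω) (r : ℝ), 0 < r → ∫⁻ z in Metric.ball x r, ‖f' z‖ₑ ∂μ < ∞ :=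
    fun x r hr => L1AddLinf_setLIntegral_lt_top hf'L (hμ.ball_finite x r hr)
  have hmod : ∀ r, modulus μ ρ f r = modulus μ ρ f' r := by
    intro r
    refine hρ.congr_ae (aemeasurable_setLAverage_enorm_sub_one hfm r) ?_
    filter_upwards [heq] with x hx
    refine laverage_congr (ae_restrict_of_ae ?_)
    filter_upwards [heq] with y hy
    rw [hx, hy]
  simp only [hmod]
  have hCne : ((2 * D * 4 + 12 * D ^ 2 : ℝ≥0) : ℝ≥0∞) ≠ 0 := by
    exact_mod_cast (show 0 < 2 * D * 4 + 12 * D ^ 2 by positivity).ne'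
  rcases eq_or_ne (∑' j : ℕ, (2⁻¹ : ℝ≥0∞) ^ j * modulus μ ρ f' (2 ^ j * t)) ∞ with htop | hfin
  · rw [htop, ENNReal.mul_top hCne]
    exact le_top
  set T := ∑' j : ℕ, (2⁻¹ : ℝ≥0∞) ^ j * modulus μ ρ f' (2 ^ j * t) with hT
  set S := oscillationSum μ f' t with hSdef
  have hoscm : ∀ r, AEMeasurable (fun x => ⨍⁻ y in Metric.ball x r, ‖f' x - f' y‖ₑ ∂μ) μ := fun r =>
    aemeasurable_setLAverage_enorm_sub_one hf'm.aemeasurable r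
  have hSm : AEMeasurable S μ := AEMeasurable.tsum fun j => (hoscm _).const_mul _
  have hSle : ρ S ≤ T := by
    refine (hρ.tsum_le fun j => (hoscm (2 ^ j * t)).const_mul _).trans ?_
    refine ENNReal.tsum_le_tsum fun j => (hρ.const_mul ?_ (hoscm _)).le
    exact ENNReal.pow_ne_top (ENNReal.inv_ne_top.2 two_ne_zero)
  have hmol : Measurable (mollify μ f' t) := measurable_mollify hf'm t
  set f₀ : Ω → ℝ := f' - mollify μ f' t with hf₀
  have hf₀m : Measurable f₀ := hf'm.sub hmol
  have hf₀le : fnNorm ρ f₀ ≤ (2 * D * 4 : ℝ≥0) * T := by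
    have h1 : ∀ x, ‖f₀ x‖ₑ ≤ (2 * D * 4 : ℝ≥0) * S x := by
      intro x
      rw [hf₀, Pi.sub_apply, ← enorm_neg, neg_sub]
      refine (mollify_local hμ hD1 hD hf'm hloc ht x).1.trans ?_
      rw [ENNReal.coe_mul (2 * D) 4, mul_assoc]
      refine mul_le_mul_right ?_ _
      have := setLAverage_le_oscillationSum (μ := μ) f' t x 2
      norm_num at this
      exact this
    refine (hρ.mono _ _ hf₀m.enorm.aemeasurable (hSm.const_mul _)
      (Filter.Eventually.of_forall h1)).trans ?_
    rw [hρ.const_mul ENNReal.coe_ne_top hSm]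
    exact mul_le_mul_right hSle _
  have hf₀X : f₀ ∈ fnSpace μ ρ := ⟨hf₀m.aemeasurable,
    hf₀le.trans_lt (ENNReal.mul_lt_top ENNReal.coe_lt_top hfin.lt_top)⟩
  set K : ℝ≥0 := 12 * D ^ 2 with hK
  -- The junk value of `toReal` at `∞` is harmless: `S` is finite outside a null set.
  set g : Ω → ℝ := fun x => K / t * (S x).toReal with hg
  have hgm : AEMeasurable g μ := hSm.ennreal_toReal.const_mul _
  have hKt : 0 ≤ (K : ℝ) / t := by positivity
  have hg0 : ∀ x, 0 ≤ g x := fun x => mul_nonneg hKt ENNReal.toReal_nonneg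
  have hgrad : g ∈ oneGradients μ (mollify μ f' t) := by
    refine ⟨hgm, hg0, {x | ¬ S x < ∞},
      hρ.ae_lt_top hSm (hSle.trans_lt hfin.lt_top), fun x hx y hy => ?_⟩
    simp only [Set.mem_ofPred_eq, not_not] at hx hy
    have h1 := enorm_mollify_sub_le hμ hD1 hD hf'm hloc ht x y
    rw [← hSdef, ← hK, ← ENNReal.ofReal_toReal (a := S x) hx.ne,
      ← ENNReal.ofReal_toReal (a := S y) hy.ne,
      ← ENNReal.ofReal_add ENNReal.toReal_nonneg ENNReal.toReal_nonneg,
      ← ENNReal.ofReal_coe_nnreal, ← ENNReal.ofReal_mul K.coe_nonneg,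
      ← ENNReal.ofReal_mul (by positivity), ← ofReal_norm,
      ENNReal.ofReal_le_ofReal_iff (by positivity)] at h1
    refine h1.trans_eq ?_
    rw [hg]
    field_simp
  have hgle : ENNReal.ofReal t * fnNorm ρ g ≤ K * T := by
    have h1 : ∀ x, ENNReal.ofReal t * ‖g x‖ₑ ≤ K * S x := by
      intro x
      rw [Real.enorm_eq_ofReal (hg0 x), ← ENNReal.ofReal_mul ht.le, hg]
      simp only
      rw [← mul_assoc, mul_div_cancel₀ _ ht.ne', ENNReal.ofReal_mul K.coe_nonneg,
        ENNReal.ofReal_coe_nnreal]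
      exact mul_le_mul_right ENNReal.ofReal_toReal_le _
    rw [fnNorm, ← hρ.const_mul ENNReal.ofReal_ne_top hgm.enorm]
    refine (hρ.mono _ _ (hgm.enorm.const_mul _) (hSm.const_mul _)
      (Filter.Eventually.of_forall h1)).trans ?_
    rw [hρ.const_mul ENNReal.coe_ne_top hSm]
    exact mul_le_mul_right hSle _
  have hgfin : fnNorm ρ g < ∞ := by
    have h2 : ENNReal.ofReal t * fnNorm ρ g < ∞ :=
      hgle.trans_lt (ENNReal.mul_lt_top ENNReal.coe_lt_top hfin.lt_top)
    by_contra hcon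
    rw [not_lt_top_iff.1 hcon, ENNReal.mul_top (by simpa using ht)] at h2
    exact lt_irrefl _ h2
  have hmolS : mollify μ f' t ∈ homSobolevSpace μ ρ := by
    refine ⟨?_, (homSobolevNorm_le hgrad).trans_lt hgfin⟩
    have h3 : mollify μ f' t = f' + -f₀ := by rw [hf₀]; abel
    rw [h3]
    exact L1AddLinf_add hf'L (L1AddLinf_neg (hρ.fnSpace_subset_L1AddLinf hf₀X))
  have hdec : f =ᵐ[μ] f₀ + mollify μ f' t := by
    rw [hf₀, sub_add_cancel]
    exact heq
  calc homK μ ρ f t ≤ fnNorm ρ f₀ + ENNReal.ofReal t * homSobolevNorm μ ρ (mollify μ f' t) :=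
        KFunctional_le t hf₀X hmolS hdec
    _ ≤ (2 * D * 4 : ℝ≥0) * T + K * T :=
        add_le_add hf₀le ((mul_le_mul_right (homSobolevNorm_le hgrad) _).trans hgle)
    _ = _ := by rw [← add_mul, ← ENNReal.coe_add]

end Decomposition

end HajlaszBesov

open HajlaszBesov

theorem mainTheorem2 {Ω : Type*} [MetricSpace Ω] [MeasurableSpace Ω] [BorelSpace Ω]
    (μ : Measure Ω) (hμ : IsRDSpace μ)
    (ρ : (Ω → ℝ≥0∞) → ℝ≥0∞) (hρ : IsRearrangementInvariantNorm μ ρ)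
    (p : ℝ) (hp : 1 ≤ p) :
    ∃ C : ℝ≥0, 0 < C ∧
      ∀ f ∈ sumSpace μ (fnSpace μ (convexification p ρ))
          (homSobolevSpace μ (convexification p ρ)),
        ∀ t : ℝ, 0 < t →
          modulus μ (convexification p ρ) f t ≤ pModulus μ p (convexification p ρ) f t ∧
          pModulus μ p (convexification p ρ) f t ≤ C * homK μ (convexification p ρ) f t ∧
          homK μ (convexification p ρ) f t
            ≤ C * ∑' j : ℕ, (2⁻¹ : ℝ≥0∞) ^ j * modulus μ (convexification p ρ) f (2 ^ j * t) ∧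
          ∑' j : ℕ, (2⁻¹ : ℝ≥0∞) ^ j * modulus μ (convexification p ρ) f (2 ^ j * t)
            ≤ ∑' j : ℕ, (2⁻¹ : ℝ≥0∞) ^ j * pModulus μ p (convexification p ρ) f (2 ^ j * t) ∧
          inhomK μ (convexification p ρ) f t
            ≤ C * (homK μ (convexification p ρ) f t
                + ENNReal.ofReal (min 1 t) * fnNorm (convexification p ρ) f) ∧
          homK μ (convexification p ρ) f t
                + ENNReal.ofReal (min 1 t) * fnNorm (convexification p ρ) f
            ≤ C * inhomK μ (convexification p ρ) f t := by
  have := hμ.sigmaFinite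
  have := hμ.secondCountableTopology
  have hX := isRearrangementInvariantNorm_convexification hρ hp
  obtain ⟨C₁, hC₁, h₁⟩ := hρ.exists_pModulus_le_homK hμ hp
  obtain ⟨C₂, -, h₂⟩ := hX.exists_homK_le hμ
  have hle₁ : (C₁ : ℝ≥0∞) ≤ (C₁ + C₂ + 2 : ℝ≥0) :=
    ENNReal.coe_le_coe.2 (le_add_right (le_add_right le_rfl))
  have hle₂ : (C₂ : ℝ≥0∞) ≤ (C₁ + C₂ + 2 : ℝ≥0) :=
    ENNReal.coe_le_coe.2 (le_add_right (le_add_left le_rfl))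
  have hle₃ : (2 : ℝ≥0∞) ≤ (C₁ + C₂ + 2 : ℝ≥0) := by
    push_cast
    exact le_add_left le_rfl
  refine ⟨C₁ + C₂ + 2, by positivity, fun f hf t ht => ?_⟩
  have hfL : f ∈ L1AddLinf μ := by
    obtain ⟨f₀, hf₀, f₁, hf₁, hsum⟩ := hf
    exact L1AddLinf_congr (L1AddLinf_add (hX.fnSpace_subset_L1AddLinf hf₀) hf₁.1) hsum.symm
  have hfm := L1AddLinf_aemeasurable hfL
  have hmod : ∀ s : ℝ, 0 < s →
      modulus μ (convexification p ρ) f s ≤ pModulus μ p (convexification p ρ) f s := fun s hs =>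
    hX.modulus_le_pModulus hμ hp hfm hs
  exact ⟨hmod t ht, (h₁ f hfm t ht).trans (mul_le_mul_left hle₁ _),
    (h₂ f hfL t ht).trans (mul_le_mul_left hle₂ _),
    ENNReal.tsum_le_tsum fun j => mul_le_mul_right (hmod _ (by positivity)) _,
    (hX.inhomK_le hfm ht).trans (mul_le_mul_left hle₃ _),
    hX.homK_add_le.trans (mul_le_mul_left hle₃ _)⟩
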